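/- **The problem.** Let $m,d,k\ge 1$. The input $I=(s^1,\dots,s^d,x^1,\dots,x^m)$ consists of $d$ keywords and $m$ words of a text, all in $\{0,1\}^k$, so it has $n=(m+d)k$ bits. Let $i_0$ be the smallest index such that $s^{i_0}$ has the maximal frequency in $(x^1,\dots,x^m)$ among all the keywords. An output is a sequence $O=(y_1,\dots,y_n)$ of indices in $\{1,\dots,d\}$, and its cost is $cost(I,O)=1+m-|\{j\in\{1,\dots,m\}: y_{(j+d)k}=i_0\}|$. **The game.** The request-answer game with buffer (buffer size $k$, integer parameter $1\le R\le k$) is played in active rounds. In each of them the algorithm may replace the content of the buffer by the next block of $k$ input bits (once), and then makes one (quantum) query to the buffer. After every $R$ active rounds the adversary asks for the next $R$ output variables. An algorithm has expected competitive ratio at most $\rho$ if $\mathbb E[cost(I,O)]\le\rho\cdot\min_{O'}cost(I,O')$ for every input $I$, where $O$ is its random output. **First-one search.** A first-one search on $\{0,1\}^N$ is a quantum query algorithm that, for every $f:\{1,\dots,N\}\to\{0,1\}$, finds with error probability at most $\frac12$ the smallest $j$ with $f(j)=1$, or reports that there is none. **The algorithm.** It uses a first-one search $F$ on $\{0,1\}^k$.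 It loads and reads (with $dk$ classical queries) the keywords one by one and puts them into an AVL tree ordered lexicographically; for each distinct keyword there is one vertex, with the smallest index of the keyword and a counter that is initially $0$. Then it loads the words $x^1,\dots,x^m$ one by one, searches each of them in the tree and, if it is found, increases the counter of the vertex by one. A word $x$ is compared with the keyword $s$ of a vertex by running $F$ on $j\mapsto[s_j\ne x_j]$ once and then $\lceil 3\log_2 m\rceil$ more times, checking each position returned by one more query, and taking the smallest mismatch found (the strings are considered equal if none is found). The answer given to the adversary is always the smallest index with the largest counter at that moment ($1$ at the beginning). **Theorem.** (1) There is a constant $c$ such that for every $N\ge1$ there is a first-one search on $\{0,1\}^N$ with at most $c\sqrt N$ queries. (2) For all constants $c$ and $A$ there is a constant $C$ such that for all $m,d,k\ge1$ and $1\le R\le k$ with $\log_2 d\le A\,m$, and for every first-one search $F$ on $\{0,1\}^k$ with at most $c\sqrt k$ queries, the algorithm with $F$ has an expected competitive ratio of at most $$C\left(1+\frac{(m\log_2 m)(\log_2 d)}{\sqrt k}\right).$$ -/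

import Mathlib

namespace QBuffer

noncomputable section

/-! ## Quantum query algorithms -/

/-- Computational basis: index register, target bit, workspace. -/
abbrev Basis (N w : ℕ) : Type := Fin N × Bool × Fin w

/-- Pure states over the computational basis. -/
abbrev QState (N w : ℕ) : Type := EuclideanSpace ℂ (Basis N w)

/-- The basis permutation `|i, b, w⟩ ↦ |i, b ⊕ f i, w⟩`. -/
def oraclePerm {N w : ℕ} (f : Fin N → Bool) : Equiv.Perm (Basis N w) where
  toFun z := (z.1, xor z.2.1 (f z.1), z.2.2)
  invFun z := (z.1, xor z.2.1 (f z.1), z.2.2)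
  left_inv z := by simp
  right_inv z := by simp

/-- The query operator of `f`. -/
def oracle {N w : ℕ} (f : Fin N → Bool) : QState N w ≃ₗᵢ[ℂ] QState N w :=
  LinearIsometryEquiv.piLpCongrLeft 2 ℂ ℂ (oraclePerm f)

/-- A quantum query circuit on `N` input bits: starting from a basis state, it applies
`U 0`, and then `T` times one query followed by `U 1`, ..., `U T`; finally all registers are
measured in the computational basis. -/
structure Circuit (N : ℕ) where
  w : ℕ
  T : ℕ
  start : Basis N w
  U : ℕ → (QState N w ≃ₗᵢ[ℂ] QState N w)

namespace Circuit

variable {N : ℕ}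

/-- The state after `t` queries to the input `f`. -/
def state (C : Circuit N) (f : Fin N → Bool) : ℕ → QState N C.w
  | 0 => C.U 0 (EuclideanSpace.single C.start 1)
  | t + 1 => C.U (t + 1) (oracle f (C.state f t))

theorem norm_state (C : Circuit N) (f : Fin N → Bool) (t : ℕ) : ‖C.state f t‖ = 1 := by
  induction t with
  | zero => simp [state]
  | succ t ih => simp [state, ih]

/-- Distribution of the result of the final measurement (Born rule). -/
def dist (C : Circuit N) (f : Fin N → Bool) : PMF (Basis N C.w) :=
  PMF.ofFintype (fun z => ENNReal.ofReal (‖C.state f C.T z‖ ^ 2)) (by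
    rw [← ENNReal.ofReal_sum_of_nonneg (fun _ _ => sq_nonneg _),
      ← EuclideanSpace.norm_sq_eq, norm_state]
    simp)

/-- The circuit that runs `C` on the function `i ↦ f i ⊕ s i`, for a known string `s`, with one
query to `f` for each query of `C`. -/
abbrev mask (C : Circuit N) (s : Fin N → Bool) : Circuit N where
  w := C.w
  T := C.T
  start := C.start
  U
    | 0 => C.U 0
    | t + 1 => (oracle s).trans (C.U (t + 1))

/-- The classical query of bit `q`: one query on `|q, 0⟩`; the answer is the target bit. -/
abbrev read (q : Fin N) : Circuit N where
  w := 1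
  T := 1
  start := (q, false, 0)
  U _ := LinearIsometryEquiv.refl ℂ _

end Circuit

/-- A quantum query algorithm on `N` bits with result in `Out`: it runs circuits, and chooses the
next one (or returns a result) according to the measurement results obtained so far. -/
inductive QAlg (N : ℕ) (Out : Type) : Type
  | ret (o : Out) : QAlg N Out
  | run (C : Circuit N) (next : Basis N C.w → QAlg N Out) : QAlg N Out

namespace QAlg

variable {N : ℕ} {Out : Type}

/-- Distribution of the result on the input `f`. -/
def dist (f : Fin N → Bool) : QAlg N Out → PMF Out
  | ret o => PMF.pure o
  | run C next => (C.dist f).bind fun z => dist f (next z)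

/-- Query complexity: the largest number of queries along a branch. -/
def maxQueries : QAlg N Out → ℕ
  | ret _ => 0
  | run C next => C.T + Finset.univ.sup fun z => maxQueries (next z)

end QAlg

/-- The first argument at which `f` is true, `none` if there is none. -/
def firstOne {N : ℕ} (f : Fin N → Bool) : Option (Fin N) := (List.finRange N).find? f

/-- `F` finds the first argument with value true (`none`: no such argument), with error probability
at most `1 / 2` on every input. -/
def IsFirstOneSearch {N : ℕ} (F : QAlg N (Option (Fin N))) : Prop :=
  ∀ f : Fin N → Bool, 1 / 2 ≤ F.dist f (firstOne f)

/-! ## The request-answer game with buffer -/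

/-- Programs of an online algorithm with a buffer of `K` bits and output alphabet `Y`. `halt`: stay
idle for the rest of the game; `output y`: from now on answer `y` whenever an output variable is
requested; `load`: load the next block to the buffer; `query C`: run the query circuit `C` on the
content of the buffer and continue according to the measurement result. -/
inductive Prog (K : ℕ) (Y : Type) : Type
  | halt : Prog K Y
  | output (y : Y) (p : Prog K Y) : Prog K Y
  | load (p : Prog K Y) : Prog K Y
  | query (C : Circuit K) (next : Basis K C.w → Prog K Y) : Prog K Y

/-- A quantum online algorithm: a program and the answer that is valid before the first `output`. -/
structure OnlineAlg (K : ℕ) (Y : Type) where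
  initial : Y
  prog : Prog K Y

/-- Content of the buffer after `l` loads: block number `l` of the input (zeros if `l = 0`, and
beyond the end of the input). -/
def buffer {n : ℕ} (K : ℕ) (I : Fin n → Bool) (l : ℕ) : Fin K → Bool := fun q =>
  if h : 0 < l ∧ (l - 1) * K + q < n then I ⟨(l - 1) * K + q, h.2⟩ else false

/-- Prepend `T` rounds (after rounds `0, ..., T - 1` the answer is `y`). -/
def delay {Y : Type} (T : ℕ) (y : Y) (g : ℕ → Y) : ℕ → Y :=
  fun t => if t < T then y else g (t - T)

/-- The random sequence whose term `t` is the answer that the algorithm gives if it is asked after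
`t` active rounds. In an active round the algorithm may load the next block once, and then it
queries the buffer once. Arguments: the program, the current answer, the number of loads so
far, and whether the current round already has had its load (a second load without a query between
opens a new round). -/
def Prog.answers {n K : ℕ} {Y : Type} (I : Fin n → Bool) :
    Prog K Y → Y → ℕ → Bool → PMF (ℕ → Y)
  | halt, y, _, _ => PMF.pure fun _ => y
  | output y' p, _, l, b => p.answers I y' l b
  | load p, y, l, b => (p.answers I y (l + 1) true).map (delay (if b then 1 else 0) y)
  | query C next, y, l, b => (C.dist (buffer K I l)).bind fun z =>
      ((next z).answers I y l (if C.T = 0 then b else false)).map (delay C.T y)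

/-- Distribution of the output `(y_1, ..., y_n)` on the input `I` in the game with parameter `R`:
after every `R` active rounds the adversary asks for the next `R` output variables. (The variable
`y_(t+1)` is the value at `t`.) -/
def OnlineAlg.outputDist {n K : ℕ} {Y : Type} (A : OnlineAlg K Y) (R : ℕ) (I : Fin n → Bool) :
    PMF (Fin n → Y) :=
  (A.prog.answers I A.initial 0 false).map fun g t => g ((t / R + 1) * R)

/-- Cost functions of online minimization problems with binary inputs of length `n` and output
alphabet `Y`; all outputs are feasible. -/
abbrev CostFun (n : ℕ) (Y : Type) : Type := (Fin n → Bool) → (Fin n → Y) → ℝ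

/-- Cost of an optimal solution. -/
def CostFun.opt {n : ℕ} {Y : Type} (cost : CostFun n Y) (I : Fin n → Bool) : ℝ :=
  ⨅ O : Fin n → Y, cost I O

/-- Expected cost of the output of an algorithm. -/
def OnlineAlg.expCost {n K : ℕ} {Y : Type} [Fintype Y] (A : OnlineAlg K Y) (R : ℕ)
    (cost : CostFun n Y) (I : Fin n → Bool) : ℝ :=
  ∑ O : Fin n → Y, (A.outputDist R I O).toReal * cost I O

/-- The algorithm is `c`-competitive in expectation, with additive constant `α`. -/
def OnlineAlg.IsCompetitive {n K : ℕ} {Y : Type} [Fintype Y] (A : OnlineAlg K Y) (R : ℕ)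
    (cost : CostFun n Y) (c α : ℝ) : Prop :=
  ∀ I : Fin n → Bool, A.expCost R cost I ≤ c * cost.opt I + α

/-! ## The most frequent keyword problem -/

section Problem

variable {m d k : ℕ}

/-- Block `b` of the input. -/
def block (I : Fin ((m + d) * k) → Bool) (b : Fin (m + d)) : Fin k → Bool := fun q =>
  I (finProdFinEquiv (b, q))

/-- The keywords are the first `d` blocks. -/
def keyword (I : Fin ((m + d) * k) → Bool) (i : Fin d) : Fin k → Bool :=
  block I ⟨i, by omega⟩

/-- The words of the text are the last `m` blocks. -/
def word (I : Fin ((m + d) * k) → Bool) (j : Fin m) : Fin k → Bool :=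
  block I ⟨d + j, by omega⟩

/-- The frequency of a string in the text. -/
def freq (I : Fin ((m + d) * k) → Bool) (t : Fin k → Bool) : ℚ :=
  (Finset.univ.filter fun j : Fin m => word I j = t).card / m

/-- The smallest index of a keyword of maximal frequency. -/
def mostFrequent [NeZero d] (I : Fin ((m + d) * k) → Bool) : Fin d :=
  (Finset.univ.filter fun i : Fin d =>
    ∀ i' : Fin d, freq I (keyword I i') ≤ freq I (keyword I i)).min' (by
      obtain ⟨i, -, hi⟩ := Finset.exists_max_image Finset.univ
        (fun i : Fin d => freq I (keyword I i)) ⟨0, Finset.mem_univ _⟩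
      exact ⟨i, by simpa using hi⟩)

/-- The position (counted from `0`) of the output variable `y_((j+d)k)`, for the word number `j`
counted from `1`. -/
def significant [NeZero k] (j : Fin m) : Fin ((m + d) * k) :=
  ⟨(j + 1 + d) * k - 1, by
    have hk : 0 < k := Nat.pos_of_ne_zero (NeZero.ne k)
    have h1 : (j + 1 + d) * k ≤ (m + d) * k := Nat.mul_le_mul_right k (by omega)
    have h2 : 0 < (j + 1 + d) * k := Nat.mul_pos (by omega) hk
    omega⟩

end Problem

/-- `1 + m` minus the number of significant output variables that are right. -/
def keywordCost (m d k : ℕ) [NeZero d] [NeZero k] : CostFun ((m + d) * k) (Fin d) := fun I O =>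
  1 + m - ∑ j : Fin m, if O (significant j) = mostFrequent I then 1 else 0

/-! ## AVL trees -/

section Tree

open BinaryTree

/-- The node `v` with subtrees `l` and `r`, rebalanced by at most a double rotation when the heights
of `l` and `r` differ by two. -/
def avlNode {α : Type} (v : α) (l r : BinaryTree α) : BinaryTree α :=
  if r.height + 1 < l.height then
    match l with
    | node lv ll (node lrv lrl lrr) =>
        if (node lrv lrl lrr).height ≤ ll.height then node lv ll (node v (node lrv lrl lrr) r)
        else node lrv (node lv ll lrl) (node v lrr r)
    | node lv ll nil => node lv ll (node v nil r)
    | nil => node v nil r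
  else if l.height + 1 < r.height then
    match r with
    | node rv (node rlv rll rlr) rr =>
        if (node rlv rll rlr).height ≤ rr.height then node rv (node v l (node rlv rll rlr)) rr
        else node rlv (node v l rll) (node rv rlr rr)
    | node rv nil rr => node rv (node v l nil) rr
    | nil => node v l nil
  else node v l r

/-- A vertex: the index of a keyword, the keyword, and the number of its occurrences so far. -/
structure Vertex (d k : ℕ) where
  idx : Fin d
  key : Fin k → Bool
  count : ℕ

variable {d k : ℕ}

open Classical in
/-- Insertion in an AVL tree ordered lexicographically by the keys; nothing happens if the key is
already there. -/
def addVertex (v : Vertex d k) : BinaryTree (Vertex d k) → BinaryTree (Vertex d k)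
  | nil => node v nil nil
  | node u l r =>
    if toLex v.key < toLex u.key then avlNode u (addVertex v l) r
    else if toLex u.key < toLex v.key then avlNode u l (addVertex v r)
    else node u l r

/-- Increase the number of occurrences in the vertex with index `i`. -/
def incr (i : Fin d) (t : BinaryTree (Vertex d k)) : BinaryTree (Vertex d k) :=
  t.map fun v => if v.idx = i then { v with count := v.count + 1 } else v

end Tree

/-! ## The algorithm -/

section Algorithm

variable {d k : ℕ} {Y : Type}

/-- Query bit `q` of the buffer. -/
def request (q : Fin k) (cont : Bool → Prog k Y) : Prog k Y :=
  .query (.read q) fun z => cont z.2.1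

/-- Query the bits in the list one by one and store them in `acc`. -/
def readBits : List (Fin k) → (Fin k → Bool) → ((Fin k → Bool) → Prog k Y) → Prog k Y
  | [], acc, cont => cont acc
  | q :: qs, acc, cont => request q fun b => readBits qs (Function.update acc q b) cont

/-- Run the query algorithm on the function `i ↦ (s i ≠ x i)`, where `x` is the content of the buffer
and `s` is a known string. -/
def searchMismatch {Out : Type} (s : Fin k → Bool) :
    QAlg k Out → (Out → Prog k Y) → Prog k Y
  | .ret o, cont => cont o
  | .run C next, cont => .query (C.mask s) fun z => searchMismatch s (next z) cont

/-- Run the search for the first mismatch the given number of times; check every position returned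
by one more query, and keep the smallest mismatch `best`. The result is the lexicographical order
of the content of the buffer relative to `s`. -/
def compareStrings (F : QAlg k (Option (Fin k))) (s : Fin k → Bool)
    (cont : Ordering → Prog k Y) : ℕ → Option (Fin k) → Prog k Y
  | 0, none => cont .eq
  | 0, some j => cont (if s j then .lt else .gt)
  | n + 1, best => searchMismatch s F fun o =>
    match o with
    | none => compareStrings F s cont n best
    | some j => request j fun b =>
        if b ≠ s j then compareStrings F s cont n (some (best.elim j (min j)))
        else compareStrings F s cont n best

/-- Search the content of the buffer in the tree; each comparison runs the search `reps` times. -/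
def findVertex (F : QAlg k (Option (Fin k))) (reps : ℕ) (cont : Option (Vertex d k) → Prog k Y) :
    BinaryTree (Vertex d k) → Prog k Y
  | .nil => cont none
  | .node v l r => compareStrings F v.key (fun
      | .lt => findVertex F reps cont l
      | .gt => findVertex F reps cont r
      | .eq => cont (some v)) reps none

/-- First phase: load the keywords one by one, read them and add them to the tree. -/
def readKeywords (cont : BinaryTree (Vertex d k) → Prog k Y) :
    List (Fin d) → BinaryTree (Vertex d k) → Prog k Y
  | [], t => cont t
  | j :: js, t => .load (readBits (List.finRange k) (fun _ => false) fun s =>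
      readKeywords cont js (addVertex ⟨j, s, 0⟩ t))

/-- Second phase: load the words one by one, search them in the tree and count; `imax` is the
smallest index with the maximal count `cmax`, and it is the current answer. -/
def processWords (F : QAlg k (Option (Fin k))) (reps : ℕ) :
    ℕ → BinaryTree (Vertex d k) → ℕ → Fin d → Prog k (Fin d)
  | 0, _, _, _ => .halt
  | n + 1, t, cmax, imax => .load (findVertex F reps (fun
      | none => processWords F reps n t cmax imax
      | some v =>
          if cmax < v.count + 1 ∨ (v.count + 1 = cmax ∧ v.idx < imax) then
            .output v.idx (processWords F reps n (incr v.idx t) (v.count + 1) v.idx)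
          else processWords F reps n (incr v.idx t) cmax imax) t)

/-- The quantum algorithm for the most frequent keyword problem, with the first-one search `F`. A
comparison consists of an initial search and `3 log₂ m` repetitions. -/
def keywordAlg (m d k : ℕ) [NeZero d] (F : QAlg k (Option (Fin k))) : OnlineAlg k (Fin d) where
  initial := 0
  prog := readKeywords
    (fun t => processWords F (1 + ⌈3 * Real.logb 2 m⌉₊) m t 0 0) (List.finRange d) .nil

end Algorithm

end

end QBuffer

/-! # Most frequent keyword with a buffer: first-one search and competitive ratio

*First-one search.* The input is bisected: a quantum search tells whether the left half of the current
window contains a one, and the window is replaced by the left or the right half. A quantum search of a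
set `S` runs Grover's algorithm with `(3 ^ j - 1) / 2` iterations for all `3 ^ j` up to about `√|S|`. If
`sin² θ` is the fraction of marked elements, such a run succeeds with probability `sin² (3 ^ j θ)`, and
some `3 ^ j θ` lies in `[π / 6, π / 2]`, so that one of the runs succeeds with probability at least
`1 / 4` (`exists_groverSchedule_success`); the costs form a geometric series. Every candidate is checked,
so the only possible error is to miss a one. At depth `i` of the bisection the search is repeated
`3 (i + 2)` times, which makes the error probability at most `2 ^ (-i - 2)`. The sum of these is at most
`1 / 2` (`le_dist_bisect`), while the halving of the windows keeps the cost at `O(√N)`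
(`maxQueries_bisect_le`).

*The competitive ratio.* An optimal solution costs `1`, so the expected cost itself has to be bounded.
The balance of the AVL tree bounds its height by `2 log₂ (d + 1)`. A comparison with `r` searches is
wrong with probability at most `2 ^ (-r)`, since one search that returns the first mismatch suffices
(`le_settleProb_compareStrings`). If all comparisons along the search paths are right, then the run
maintains the invariant `CountInv`, and the answer after the last word is right. Hence, with
`r ≥ 1 + 3 log₂ m` and height `H`, the probability of failure is at most `m H 2 ^ (-r) ≤ H / (2 m²)`. It
contributes `H / (2 m)` to the expected cost, and this is bounded because of `log₂ d ≤ A m`. In the case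
of success the answer is right as soon as the words have been processed, which takes
`T = O(m · log₂ m · log₂ d · √k)` rounds; meanwhile at most `T / k` significant output variables are
requested (`expCost_le_of_settleProb`). -/

namespace QBuffer

open scoped ENNReal

/-! ### Mixtures of distributions and simple circuits -/

/-- Amplification: if the failure probability `ε` is replaced by certainty on an event of probability at
least `p`, then the failure probability decreases to `(1 - p) * ε`. -/
theorem le_tsum_mul_of_le_tsum_indicator {α : Type*} (μ : PMF α) (s : Set α) {p ε a : ℝ≥0∞} {v : α → ℝ≥0∞}
    (hp1 : p ≤ 1) (hε : ε ≤ 1) (hp : p ≤ ∑' x, s.indicator μ x)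
    (hv : ∀ x, (1 - ε) * a ≤ v x) (hs : ∀ x ∈ s, a ≤ v x) :
    (1 - (1 - p) * ε) * a ≤ ∑' x, μ x * v x := by
  classical
  have h1 : (1 - (1 - p) * ε) ≤ (1 - ε) + p * ε := by
    rw [tsub_le_iff_right, add_assoc, ← add_mul, add_tsub_cancel_of_le hp1, one_mul,
      tsub_add_cancel_of_le hε]
  calc (1 - (1 - p) * ε) * a ≤ ((1 - ε) + p * ε) * a := by gcongr
    _ ≤ ((1 - ε) + (∑' x, s.indicator μ x) * ε) * a := by gcongr
    _ = ∑' x, (μ x * ((1 - ε) * a) + s.indicator μ x * (ε * a)) := by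
        rw [ENNReal.tsum_add, ENNReal.tsum_mul_right, ENNReal.tsum_mul_right, μ.tsum_coe]
        ring
    _ ≤ ∑' x, μ x * v x := by
        refine ENNReal.tsum_le_tsum fun x => ?_
        by_cases hx : x ∈ s
        · rw [Set.indicator_of_mem hx, ← mul_add, ← add_mul, tsub_add_cancel_of_le hε, one_mul]
          gcongr
          exact hs x hx
        · rw [Set.indicator_of_notMem hx, zero_mul, add_zero]
          gcongr
          exact hv x

theorem le_tsum_mul_of_forall_le {α : Type*} (μ : PMF α) {a : ℝ≥0∞} {v : α → ℝ≥0∞}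
    (hv : ∀ x, a ≤ v x) : a ≤ ∑' x, μ x * v x := by
  calc a = ∑' x, μ x * a := by rw [ENNReal.tsum_mul_right, μ.tsum_coe, one_mul]
    _ ≤ _ := ENNReal.tsum_le_tsum fun x => by gcongr; exact hv x

theorem firstOne_eq_some {N : ℕ} {f : Fin N → Bool} {j : Fin N} :
    firstOne f = some j ↔ f j = true ∧ ∀ i < j, f i = false := by
  unfold firstOne
  rw [List.find?_eq_some_iff_getElem]
  refine and_congr_right fun _ => ⟨?_, fun h => ⟨j, by simp, by simp, fun i hi => ?_⟩⟩
  · rintro ⟨i, hi, rfl, h⟩ k hk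
    simpa using h k (by simpa [Fin.lt_def] using hk)
  · simpa using h ⟨i, hi.trans j.2⟩ hi

theorem firstOne_eq_none {N : ℕ} {f : Fin N → Bool} :
    firstOne f = none ↔ ∀ i, f i = false := by
  simp [firstOne, List.find?_eq_none]

theorem oracle_apply {N w : ℕ} (f : Fin N → Bool) (v : QState N w) (z : Basis N w) :
    oracle f v z = v (z.1, xor z.2.1 (f z.1), z.2.2) := by
  rfl

theorem oracle_oracle {N w : ℕ} (f g : Fin N → Bool) (v : QState N w) :
    oracle f (oracle g v) = oracle (fun i => xor (g i) (f i)) v := by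
  ext z
  simp only [oracle_apply, Bool.xor_assoc, Bool.xor_comm (f z.1)]

theorem Circuit.dist_mask {N : ℕ} (C : Circuit N) (s f : Fin N → Bool) :
    (C.mask s).dist f = C.dist (fun i => xor (f i) (s i)) := by
  have h : ∀ t, (C.mask s).state f t = C.state (fun i => xor (f i) (s i)) t := by
    intro t
    induction t with
    | zero => rfl
    | succ t ih =>
      change C.U (t + 1) (oracle s (oracle f ((C.mask s).state f t))) = _
      rw [oracle_oracle, ih]
      rfl
  ext z
  change ENNReal.ofReal (‖(C.mask s).state f C.T z‖ ^ 2) = _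
  rw [h]
  rfl

theorem Circuit.dist_read {N : ℕ} (f : Fin N → Bool) (q : Fin N) :
    (Circuit.read q).dist f = PMF.pure (q, f q, 0) := by
  have h : (Circuit.read q).state f 1 = EuclideanSpace.single (q, f q, 0) 1 := by
    ext ⟨i, b, u⟩
    change (EuclideanSpace.single (q, false, (0 : Fin 1)) (1 : ℂ) : QState N 1) (i, xor b (f i), u) = _
    by_cases hi : i = q
    · subst hi
      simp [Subsingleton.elim u 0]
    · simp [hi]
  ext z
  change ENNReal.ofReal (‖(Circuit.read q).state f 1 z‖ ^ 2) = _
  rw [h]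
  by_cases hz : z = (q, f q, 0)
  · subst hz; simp
  · rw [PMF.pure_apply_of_ne _ _ hz]
    simp [hz]

/-! ### Grover's algorithm on a subset -/

section Grover

variable {N : ℕ}

/-- The state `∑ i ∈ S, h i |i⟩` tensored with `(|0⟩ - |1⟩) / √2`, scaled by `1 / √|S|`: it has norm one
for `h = 1`. -/
noncomputable def kickbackState (S : Finset (Fin N)) (h : Fin N → ℝ) : QState N 1 :=
  WithLp.toLp 2 fun z =>
    if z.1 ∈ S then ((h z.1 * (if z.2.1 then -1 else 1) / √(2 * S.card) : ℝ) : ℂ) else 0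

theorem kickbackState_apply (S : Finset (Fin N)) (h : Fin N → ℝ) (z : Basis N 1) :
    kickbackState S h z =
      if z.1 ∈ S then ((h z.1 * (if z.2.1 then -1 else 1) / √(2 * S.card) : ℝ) : ℂ) else 0 :=
  rfl

/-- Phase kickback: a query changes the sign at the marked elements. -/
theorem oracle_kickbackState (S : Finset (Fin N)) (h : Fin N → ℝ) (f : Fin N → Bool) :
    oracle f (kickbackState S h) = kickbackState S fun i => if f i then -h i else h i := by
  ext ⟨i, b, u⟩
  simp only [oracle_apply, kickbackState_apply]
  cases b <;> cases f i <;> simp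

/-- If `S` is empty, then both sides are zero (division by zero). -/
theorem inner_kickbackState (S : Finset (Fin N)) (h g : Fin N → ℝ) :
    inner ℂ (kickbackState S h) (kickbackState S g) =
      (((∑ i ∈ S, h i * g i) / S.card : ℝ) : ℂ) := by
  have h2 : ∀ x y : ℝ, 2 * ((x / √(2 * S.card)) * (y / √(2 * S.card))) = x * y / S.card := by
    intro x y
    rw [div_mul_div_comm, Real.mul_self_sqrt (by positivity), mul_div_mul_comm, ← mul_assoc]
    by_cases hS : (S.card : ℝ) = 0
    · simp [hS]
    · field_simp
  rw [PiLp.inner_apply, Fintype.sum_prod_type, Finset.sum_div]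
  rw [← Finset.sum_filter_add_sum_filter_not Finset.univ (· ∈ S)]
  rw [Finset.sum_eq_zero (s := Finset.univ.filter (· ∉ S)), add_zero, Finset.filter_mem_eq_inter,
    Finset.univ_inter]
  · push_cast
    refine Finset.sum_congr rfl fun i hi => ?_
    have := congrArg (fun x : ℝ => (x : ℂ)) (h2 (h i) (g i))
    push_cast at this
    simp [Fintype.sum_prod_type, kickbackState_apply, hi, ← this]
    ring
  · intro i hi
    simp only [Finset.mem_filter, Finset.mem_univ, true_and] at hi
    simp [kickbackState_apply, hi]

theorem norm_kickbackState_one {S : Finset (Fin N)} (hS : S.Nonempty) :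
    ‖kickbackState S fun _ => 1‖ = 1 := by
  have h0 : (S.card : ℝ) ≠ 0 := by simpa using hS.ne_empty
  rw [norm_eq_sqrt_re_inner (𝕜 := ℂ), inner_kickbackState]
  simp [h0]

theorem reflection_kickbackState {S : Finset (Fin N)} (hS : S.Nonempty) (h : Fin N → ℝ) :
    (ℂ ∙ kickbackState S fun _ => 1).reflection (kickbackState S h) =
      kickbackState S fun i => 2 * ((∑ i ∈ S, h i) / S.card) - h i := by
  rw [Submodule.reflection_singleton_apply, inner_kickbackState, norm_kickbackState_one hS]
  ext z
  simp only [PiLp.sub_apply, PiLp.smul_apply, kickbackState_apply]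
  split_ifs <;> simp <;> ring

theorem reflection_sub_of_inner_eq {E : Type*} [NormedAddCommGroup E] [InnerProductSpace ℂ E]
    {v w : E} (h : ‖v‖ = ‖w‖) (hi : inner ℂ v w = inner ℂ w v) :
    ((ℂ ∙ (v - w))ᗮ).reflection v = w := by
  set R := ((ℂ ∙ (v - w))ᗮ).reflection
  suffices R v + R v = w + w by
    have h2 : (2 : ℂ) • R v = (2 : ℂ) • w := by rw [two_smul, two_smul, this]
    exact smul_right_injective E (two_ne_zero : (2 : ℂ) ≠ 0) h2
  have h₁ : R (v - w) = -(v - w) :=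
    Submodule.reflection_orthogonalComplement_singleton_eq_neg (v - w)
  have h₂ : R (v + w) = v + w := by
    apply Submodule.reflection_mem_subspace_eq_self
    rw [Submodule.mem_orthogonal_singleton_iff_inner_left, inner_sub_right, inner_add_left,
      inner_add_left, inner_self_eq_norm_sq_to_K, inner_self_eq_norm_sq_to_K, h, hi]
    ring
  convert congr_arg₂ (· + ·) h₂ h₁ using 1
  · simp
  · abel

variable [NeZero N]

/-- Grover's algorithm on the subset `S` with `t` iterations: the reflection at the first step takes the
starting basis state to the uniform superposition, the others are the diffusion operator. -/
noncomputable abbrev grover (S : Finset (Fin N)) (t : ℕ) : Circuit N where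
  w := 1
  T := t
  start := (0, false, 0)
  U
    | 0 => ((ℂ ∙ (EuclideanSpace.single (0, false, 0) 1 - kickbackState S fun _ => 1))ᗮ).reflection
    | _ + 1 => (ℂ ∙ kickbackState S fun _ => 1).reflection

/-- The states of Grover's algorithm stay in the plane spanned by the marked and the unmarked part of
the uniform superposition; `sin θ * x` and `cos θ * y` are the coordinates with respect to the normalized
parts, and each iteration is a rotation by `2 θ`. -/
theorem grover_state {S : Finset (Fin N)} (hS : S.Nonempty) (f : Fin N → Bool) {θ : ℝ}
    (hθ : Real.sin θ ^ 2 = (S.filter (f ·)).card / S.card) (T t : ℕ) :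
    ∃ x y : ℝ, (grover S T).state f t = kickbackState S (fun i => if f i then x else y) ∧
      Real.sin θ * x = Real.sin ((2 * t + 1) * θ) ∧
      Real.cos θ * y = Real.cos ((2 * t + 1) * θ) := by
  have h0 : (S.card : ℝ) ≠ 0 := by simpa using hS.ne_empty
  induction t with
  | zero =>
    refine ⟨1, 1, ?_, by simp, by simp⟩
    simp only [ite_self]
    refine reflection_sub_of_inner_eq ?_ ?_
    · rw [norm_kickbackState_one hS]; simp
    · rw [← inner_conj_symm, EuclideanSpace.inner_single_right, kickbackState_apply]
      split_ifs <;> simp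
  | succ t ih =>
    obtain ⟨x, y, hst, hx, hy⟩ := ih
    have hm : (∑ i ∈ S, if f i then -x else y) / S.card =
        - Real.sin θ ^ 2 * x + Real.cos θ ^ 2 * y := by
      have hc : ((S.filter (f ·)).card : ℝ) + (S.filter (fun i => ¬ f i)).card = S.card := by
        exact_mod_cast S.card_filter_add_card_filter_not (f ·)
      rw [Real.cos_sq', hθ, Finset.sum_ite, Finset.sum_const, Finset.sum_const]
      field_simp
      rw [← hc]
      simp only [nsmul_eq_mul]
      ring
    refine ⟨2 * (- Real.sin θ ^ 2 * x + Real.cos θ ^ 2 * y) + x,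
      2 * (- Real.sin θ ^ 2 * x + Real.cos θ ^ 2 * y) - y, ?_, ?_, ?_⟩
    · change (ℂ ∙ kickbackState S fun _ => 1).reflection (oracle f ((grover S T).state f t)) = _
      rw [hst, oracle_kickbackState, reflection_kickbackState hS]
      have : (fun i => if f i then -(if f i then x else y) else if f i then x else y) =
          fun i => if f i then -x else y := by
        ext i; split_ifs <;> rfl
      simp only [this, hm]
      congr 1
      ext i
      split_ifs <;> ring
    · have e : ((2 * ((t + 1 : ℕ) : ℝ) + 1) * θ) = (2 * t + 1) * θ + 2 * θ := by push_cast; ring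
      rw [e, Real.sin_add, ← hx, ← hy, Real.sin_two_mul, Real.cos_two_mul, Real.cos_sq']
      linear_combination (-2 * Real.sin θ * y) * Real.sin_sq_add_cos_sq θ
    · have e : ((2 * ((t + 1 : ℕ) : ℝ) + 1) * θ) = (2 * t + 1) * θ + 2 * θ := by push_cast; ring
      rw [e, Real.cos_add, ← hx, ← hy, Real.sin_two_mul, Real.cos_two_mul, Real.cos_sq']
      ring

/-- Grover's algorithm finds a marked element of `S` with probability `sin² ((2t + 1) θ)`. -/
theorem grover_success {S : Finset (Fin N)} (hS : S.Nonempty) (f : Fin N → Bool) {θ : ℝ}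
    (hθ : Real.sin θ ^ 2 = (S.filter (f ·)).card / S.card) (t : ℕ) :
    ENNReal.ofReal (Real.sin ((2 * t + 1) * θ) ^ 2) ≤
      ∑' z, {z : Basis N 1 | z.1 ∈ S ∧ f z.1}.indicator ((grover S t).dist f) z := by
  obtain ⟨x, y, hst, hx, -⟩ := grover_state hS f hθ t t
  have hd : ∀ z, (grover S t).dist f z =
      ENNReal.ofReal (‖kickbackState S (fun i => if f i then x else y) z‖ ^ 2) := by
    intro z
    rw [← hst]
    rfl
  have h0 : (S.card : ℝ) ≠ 0 := by simpa using hS.ne_empty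
  have h1 : ∀ b : Bool, (x * (if b then -1 else 1) / √(2 * S.card)) ^ 2 =
      x ^ 2 / (2 * S.card) := by
    intro b
    rw [div_pow, Real.sq_sqrt (by positivity), mul_pow]
    cases b <;> simp
  have h2 : ∀ z : Basis N 1, {z : Basis N 1 | z.1 ∈ S ∧ f z.1}.indicator ((grover S t).dist f) z =
      ENNReal.ofReal (if z.1 ∈ S.filter (f ·) then x ^ 2 / (2 * S.card) else 0) := by
    intro z
    by_cases hz : z.1 ∈ S ∧ f z.1
    · have hz' : z ∈ {z : Basis N 1 | z.1 ∈ S ∧ f z.1} := hz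
      rw [Set.indicator_of_mem hz', hd, kickbackState_apply, if_pos hz.1, if_pos hz.2,
        Complex.norm_real, Real.norm_eq_abs, sq_abs, h1,
        if_pos (by simpa using hz)]
    · have hz' : z ∉ {z : Basis N 1 | z.1 ∈ S ∧ f z.1} := hz
      rw [Set.indicator_of_notMem hz', if_neg (by simpa using hz), ENNReal.ofReal_zero]
  have h3 : ∑ z : Basis N 1, (if z.1 ∈ S.filter (f ·) then x ^ 2 / (2 * S.card) else 0) =
      (S.filter (f ·)).card * (2 * (x ^ 2 / (2 * S.card))) := by
    generalize S.filter (f ·) = A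
    simp [Fintype.sum_prod_type, Finset.sum_add_distrib]
    ring
  rw [tsum_congr h2, tsum_fintype, ← ENNReal.ofReal_sum_of_nonneg]
  · refine ENNReal.ofReal_le_ofReal (le_of_eq (Eq.trans ?_ h3.symm))
    rw [← hx, mul_pow, hθ]
    field_simp
  · intro z _
    split_ifs <;> positivity

/-- The numbers of iterations `(3 ^ j - 1) / 2`, `j ≤ J`: they multiply the angle by `3 ^ j`. -/
def groverSchedule (J : ℕ) : List ℕ := (List.range (J + 1)).map fun j => (3 ^ j - 1) / 2

/-- One of the scheduled numbers of iterations is good: the powers of three cannot skip the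
interval `[π / 6, π / 2]`. -/
theorem exists_groverSchedule_success {S : Finset (Fin N)} (f : Fin N → Bool)
    (hf : ∃ i ∈ S, f i) {J : ℕ} (hJ : S.card ≤ 9 ^ J) :
    ∃ t ∈ groverSchedule J, (1 / 4 : ℝ≥0∞) ≤
      ∑' z, {z : Basis N 1 | z.1 ∈ S ∧ f z.1}.indicator ((grover S t).dist f) z := by
  obtain ⟨i₀, hi₀, hfi₀⟩ := hf
  have hS : S.Nonempty := ⟨i₀, hi₀⟩
  have hcard : (0 : ℝ) < S.card := by exact_mod_cast hS.card_pos
  set g : ℝ := (S.filter (f ·)).card / S.card with hg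
  have hg1 : g ≤ 1 := by
    rw [hg, div_le_one hcard]
    exact_mod_cast Finset.card_filter_le _ _
  have hgJ : 1 ≤ 9 ^ J * g := by
    have h1 : (1 : ℝ) ≤ (S.filter (f ·)).card := by
      exact_mod_cast Finset.card_pos.2 ⟨i₀, by simp [hi₀, hfi₀]⟩
    rw [hg, mul_div_assoc', le_div_iff₀ hcard]
    have h2 : (S.card : ℝ) ≤ 9 ^ J := by exact_mod_cast hJ
    nlinarith
  have hg0 : 0 ≤ g := by positivity
  set θ := Real.arcsin √g with hθ
  have hs : Real.sin θ = √g :=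
    Real.sin_arcsin (by linarith [Real.sqrt_nonneg g]) (Real.sqrt_le_one.2 hg1)
  have hs2 : Real.sin θ ^ 2 = g := by rw [hs, Real.sq_sqrt hg0]
  have hθ0 : 0 ≤ θ := Real.arcsin_nonneg.2 (Real.sqrt_nonneg g)
  have hlarge : ∃ j : ℕ, Real.pi / 6 ≤ 3 ^ j * θ ∧ j ≤ J := by
    refine ⟨J, ?_, le_rfl⟩
    -- `3 ^ J * θ ≥ 3 ^ J * √g ≥ 1 ≥ π / 6`
    have h1 : √g ≤ θ := hs ▸ Real.sin_le hθ0
    have h2 : 1 ≤ 3 ^ J * √g := by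
      have : (1 : ℝ) ≤ √(9 ^ J * g) := Real.one_le_sqrt.2 hgJ
      rwa [Real.sqrt_mul (by positivity), show (9 : ℝ) ^ J = (3 ^ J) ^ 2 by
        rw [← pow_mul, mul_comm, pow_mul]; norm_num, Real.sqrt_sq (by positivity)] at this
    have h3 : (3 : ℝ) ^ J * √g ≤ 3 ^ J * θ := by gcongr
    linarith [Real.pi_le_four]
  classical
  obtain ⟨hj, hjJ⟩ := Nat.find_spec hlarge
  set j := Nat.find hlarge with hjdef
  have hup : 3 ^ j * θ ≤ Real.pi / 2 := by
    rcases Nat.eq_zero_or_pos j with h | h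
    · rw [h]; simpa using Real.arcsin_le_pi_div_two _
    · have hm := Nat.find_min hlarge (m := j - 1) (by omega)
      have hlt : 3 ^ (j - 1) * θ < Real.pi / 6 := by
        by_contra hcon
        exact hm ⟨not_lt.1 hcon, by omega⟩
      have : (3 : ℝ) ^ j = 3 * 3 ^ (j - 1) := by
        rw [← pow_succ']; congr 1; omega
      rw [this]; linarith
  refine ⟨(3 ^ j - 1) / 2, List.mem_map.2 ⟨j, by simp; omega, rfl⟩, ?_⟩
  refine le_trans ?_ (grover_success hS f (hs2.trans hg) _)
  have hodd : 2 * ((((3 ^ j - 1) / 2 : ℕ)) : ℝ) + 1 = 3 ^ j := by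
    have h1 : 2 * ((3 ^ j - 1) / 2) + 1 = 3 ^ j := by
      have : 3 ^ j % 2 = 1 := Nat.odd_iff.1 (Odd.pow (by decide))
      generalize 3 ^ j = n at this ⊢
      omega
    exact_mod_cast h1
  rw [hodd]
  have hsin : 1 / 2 ≤ Real.sin (3 ^ j * θ) := by
    rw [← Real.sin_pi_div_six]
    exact Real.sin_le_sin_of_le_of_le_pi_div_two (by linarith [Real.pi_pos]) hup hj
  calc (1 / 4 : ℝ≥0∞) = ENNReal.ofReal (1 / 4) := by
        rw [ENNReal.ofReal_div_of_pos (by norm_num)]; simp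
    _ ≤ _ := ENNReal.ofReal_le_ofReal (by nlinarith)

end Grover

/-! ### First-one search by bisection -/

section Search

variable {N : ℕ} {Out : Type}

theorem QAlg.dist_run_apply (f : Fin N → Bool) (C : Circuit N) (next : Basis N C.w → QAlg N Out)
    (o : Out) : (QAlg.run C next).dist f o = ∑' z, C.dist f z * (next z).dist f o :=
  PMF.bind_apply _ _ _

theorem QAlg.dist_run_read (f : Fin N → Bool) (q : Fin N)
    (next : Basis N (Circuit.read q).w → QAlg N Out) :
    (QAlg.run (Circuit.read q) next).dist f = (next (q, f q, 0)).dist f := by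
  rw [QAlg.dist, Circuit.dist_read, PMF.pure_bind]

variable [NeZero N]

/-- Run Grover's algorithm on `S` with each number of iterations in the list, until a marked element
of `S` has been found and checked by one more query; `next` gets the information whether one has
been found. -/
noncomputable def searchWith (S : Finset (Fin N)) (next : Bool → QAlg N Out) :
    List ℕ → QAlg N Out
  | [] => next false
  | t :: ts => .run (grover S t) fun z =>
      if z.1 ∈ S then .run (.read z.1) fun u => if u.2.1 then next true else searchWith S next ts
      else searchWith S next ts

theorem dist_searchWith_cons (f : Fin N → Bool) (S : Finset (Fin N)) (next : Bool → QAlg N Out)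
    (t : ℕ) (ts : List ℕ) (o : Out) :
    (searchWith S next (t :: ts)).dist f o = ∑' z, (grover S t).dist f z *
      if z.1 ∈ S ∧ f z.1 then (next true).dist f o else (searchWith S next ts).dist f o := by
  rw [searchWith, QAlg.dist_run_apply]
  refine tsum_congr fun z => ?_
  congr 1
  by_cases hz : z.1 ∈ S
  · rw [if_pos hz, QAlg.dist_run_read]
    by_cases hf : f z.1 = true <;> simp [hz, hf]
  · simp [hz]

/-- If nothing is marked, then nothing is found, since every candidate is checked. -/
theorem le_dist_searchWith_of_forall_not {f : Fin N → Bool} {S : Finset (Fin N)}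
    {next : Bool → QAlg N Out} {o : Out} (hf : ∀ i ∈ S, f i = false) (L : List ℕ) :
    (next false).dist f o ≤ (searchWith S next L).dist f o := by
  induction L with
  | nil => exact le_rfl
  | cons t ts ih =>
    rw [dist_searchWith_cons]
    refine le_tsum_mul_of_forall_le _ fun z => ?_
    rwa [if_neg fun h => by simp [hf z.1 h.1] at h]

theorem le_dist_searchWith_append {f : Fin N → Bool} {S : Finset (Fin N)}
    {next : Bool → QAlg N Out} {o : Out} {a : ℝ≥0∞} (ha : a ≤ (next true).dist f o)
    (L L' : List ℕ) (h : a ≤ (searchWith S next L').dist f o) :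
    a ≤ (searchWith S next (L ++ L')).dist f o := by
  induction L with
  | nil => exact h
  | cons t ts ih =>
    rw [List.cons_append, dist_searchWith_cons]
    refine le_tsum_mul_of_forall_le _ fun z => ?_
    split_ifs <;> assumption

/-- One run of the schedule reduces the failure probability by the factor `3 / 4`. -/
theorem le_dist_searchWith_groverSchedule {f : Fin N → Bool} {S : Finset (Fin N)}
    {next : Bool → QAlg N Out} {o : Out} (hf : ∃ i ∈ S, f i) {J : ℕ} (hJ : S.card ≤ 9 ^ J)
    (r : ℕ) :
    (1 - (3 / 4) ^ r) * (next true).dist f o ≤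
      (searchWith S next (List.replicate r (groverSchedule J)).flatten).dist f o := by
  have h34 : (1 : ℝ≥0∞) - 1 / 4 = 3 / 4 := by
    rw [← ENNReal.toReal_eq_toReal_iff' (by simp) (by finiteness),
      ENNReal.toReal_sub_of_le (by simp) (by simp)]
    norm_num
  have h34' : (3 / 4 : ℝ≥0∞) ≤ 1 := h34 ▸ tsub_le_self
  induction r with
  | zero => simp
  | succ r ih =>
    obtain ⟨t, ht, hsucc⟩ := exists_groverSchedule_success f hf hJ
    obtain ⟨L₁, L₂, hL⟩ := List.append_of_mem ht
    rw [List.replicate_succ, List.flatten_cons, hL, List.append_assoc, List.cons_append]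
    have hle : ∀ s : ℕ, (1 - (3 / 4) ^ s) * (next true).dist f o ≤ (next true).dist f o :=
      fun s => mul_le_of_le_one_left' tsub_le_self
    refine le_dist_searchWith_append (hle _) _ _ ?_
    rw [dist_searchWith_cons, pow_succ', ← h34]
    refine le_tsum_mul_of_le_tsum_indicator _ {z : Basis N 1 | z.1 ∈ S ∧ f z.1} (by simp) ?_ hsucc ?_ ?_
    · rw [h34]; exact pow_le_one' h34' _
    · intro z
      rw [h34]
      split_ifs
      · exact hle _
      · exact le_dist_searchWith_append (hle _) _ _ (by rw [← hL]; exact ih)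
    · intro z hz
      exact (if_pos (show z.1 ∈ S ∧ f z.1 from hz)).ge

theorem maxQueries_searchWith_le (S : Finset (Fin N)) (next : Bool → QAlg N Out) {M : ℕ}
    (hM : ∀ b, (next b).maxQueries ≤ M) (L : List ℕ) :
    (searchWith S next L).maxQueries ≤ (L.map (· + 1)).sum + M := by
  induction L with
  | nil => simpa [searchWith] using hM false
  | cons t ts ih =>
    simp only [searchWith, QAlg.maxQueries, List.map_cons, List.sum_cons]
    have : (Finset.univ.sup fun z : Basis N 1 => QAlg.maxQueries
        (if z.1 ∈ S then .run (.read z.1) fun u => if u.2.1 then next true else searchWith S next ts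
          else searchWith S next ts)) ≤ 1 + ((ts.map (· + 1)).sum + M) := by
      refine Finset.sup_le fun z _ => ?_
      split_ifs
      · simp only [QAlg.maxQueries]
        refine Nat.add_le_add_left (Finset.sup_le fun u _ => ?_) 1
        split_ifs
        · exact (hM true).trans (Nat.le_add_left _ _)
        · exact ih
      · exact ih.trans (Nat.le_add_left _ _)
    exact (Nat.add_le_add_left this _).trans (by omega)

theorem sum_groverSchedule_le (J : ℕ) :
    2 * ((groverSchedule J).map (· + 1)).sum ≤ 3 * 3 ^ J := by
  induction J with
  | zero => simp [groverSchedule]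
  | succ J ih =>
    rw [groverSchedule, List.range_succ, List.map_append, List.map_append, List.sum_append]
    rw [groverSchedule] at ih
    simp only [List.map_cons, List.map_nil, List.sum_cons, List.sum_nil]
    have h3 : 0 < 3 ^ J := by positivity
    rw [pow_succ]
    generalize 3 ^ J = n at *
    omega

/-- The elements `i` of `Fin N` with `a ≤ i < a + l`. -/
def window (a l : ℕ) : Finset (Fin N) := Finset.univ.filter fun i => a ≤ i.1 ∧ i.1 < a + l

omit [NeZero N] in
theorem card_window_le (a l : ℕ) : (window a l : Finset (Fin N)).card ≤ l := by
  have : ((window a l : Finset (Fin N)).image Fin.val) ⊆ Finset.Ico a (a + l) := by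
    intro i
    simp only [window, Finset.mem_image, Finset.mem_filter, Finset.mem_Ico]
    rintro ⟨j, ⟨-, h⟩, rfl⟩
    exact h
  rw [← Finset.card_image_of_injective _ Fin.val_injective]
  simpa using Finset.card_le_card this

/-- Bisection for the first marked element in the window `[a, a + 2 ^ n)`, at depth `i`: a
quantum search tells whether the left half contains a marked element. The number of repetitions
grows with the depth, so that the error probabilities have a small sum. -/
noncomputable def bisect : (n i a : ℕ) → QAlg N (Option (Fin N))
  | 0, _, a => if h : a < N then
      .run (.read ⟨a, h⟩) fun u => .ret (if u.2.1 then some ⟨a, h⟩ else none) else .ret none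
  | n + 1, i, a => searchWith (window a (2 ^ n))
      (fun b => if b then bisect n (i + 1) a else bisect n (i + 1) (a + 2 ^ n))
      (List.replicate (3 * (i + 2)) (groverSchedule (Nat.clog 9 (2 ^ n)))).flatten

theorem three_quarters_pow_le (i : ℕ) : ((3 / 4 : ℝ≥0∞)) ^ (3 * i) ≤ (1 / 2) ^ i := by
  rw [pow_mul]
  refine pow_le_pow_left' ?_ i
  rw [← ENNReal.toReal_le_toReal (by finiteness) (by simp)]
  norm_num

theorem le_dist_bisect (f : Fin N → Bool) (n : ℕ) : ∀ i a : ℕ,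
    (∀ j : Fin N, j.1 < a → f j = false) →
    ((∀ j, f j = false) ∨ ∃ j : Fin N, f j ∧ j.1 < a + 2 ^ n) →
    1 - (1 / 2) ^ (i + 1) ≤ (bisect n i a).dist f (firstOne f) := by
  induction n with
  | zero =>
    intro i a hlt hex
    refine tsub_le_self.trans ?_
    have key : ∀ h : a < N, firstOne f = if f ⟨a, h⟩ then some ⟨a, h⟩ else none := by
      intro h
      split_ifs with hf
      · exact firstOne_eq_some.2 ⟨hf, fun j hj => hlt j hj⟩
      · rcases hex with h0 | ⟨j, hj, hja⟩
        · exact firstOne_eq_none.2 h0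
        · rcases Nat.lt_or_ge j.1 a with h' | h'
          · simp [hlt j h'] at hj
          · exact absurd (by convert hj using 2; ext; simp at hja ⊢; omega) hf
    rw [bisect]
    split_ifs with h
    · rw [QAlg.dist_run_read, key h]
      simp [QAlg.dist]
    · rw [firstOne_eq_none.2 fun j => hlt j (by omega)]
      simp [QAlg.dist]
  | succ n ih =>
    intro i a hlt hex
    rw [bisect]
    have hhalf : (1 / 2 : ℝ≥0∞) ^ (i + 1) = (1 / 2) ^ (i + 2) + (1 / 2) ^ (i + 2) := by
      rw [pow_succ (1 / 2 : ℝ≥0∞) (i + 1), ← mul_add, ENNReal.add_halves, mul_one]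
    have hle1 : (1 / 2 : ℝ≥0∞) ^ (i + 2) ≤ 1 := pow_le_one' (by simp) _
    by_cases hl : ∃ j ∈ (window a (2 ^ n) : Finset (Fin N)), f j
    · refine le_trans ?_ (le_dist_searchWith_groverSchedule hl
        ((card_window_le _ _).trans (Nat.le_pow_clog (by norm_num) _)) _)
      have h1 := ih (i + 1) a hlt (Or.inr (by
        obtain ⟨j, hj, hfj⟩ := hl
        simp only [window, Finset.mem_filter] at hj
        exact ⟨j, hfj, hj.2.2⟩))
      calc (1 : ℝ≥0∞) - (1 / 2) ^ (i + 1)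
          ≤ (1 - (1 / 2) ^ (i + 2)) * (1 - (1 / 2) ^ (i + 2)) := by
            rw [ENNReal.mul_sub (fun _ _ => by finiteness), mul_one, hhalf, ← tsub_tsub]
            exact tsub_le_tsub_left (mul_le_of_le_one_left' tsub_le_self) _
        _ ≤ _ := by
            refine mul_le_mul' (tsub_le_tsub_left (three_quarters_pow_le _) _) ?_
            simpa using h1
    · push Not at hl
      refine le_trans ?_ (le_dist_searchWith_of_forall_not (fun j hj => by simpa using hl j hj) _)
      have h1 := ih (i + 1) (a + 2 ^ n) (fun j hj => by
          rcases Nat.lt_or_ge j.1 a with h' | h'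
          · exact hlt j h'
          · simpa using hl j (by simp [window, h', hj]))
        (hex.imp_right fun ⟨j, hj, hj'⟩ => ⟨j, hj, by rw [pow_succ] at hj'; omega⟩)
      refine le_trans (b := (1 : ℝ≥0∞) - (1 / 2) ^ (i + 2)) (tsub_le_tsub_left ?_ _)
        (by simpa using h1)
      rw [hhalf]
      exact le_self_add

theorem maxQueries_bisect_le (n : ℕ) : ∀ i a : ℕ,
    ((bisect n i a : QAlg N (Option (Fin N))).maxQueries : ℝ) ≤ 36 * (i + 6) * √2 ^ n := by
  have hs : (7 / 5 : ℝ) ≤ √2 := Real.le_sqrt_of_sq_le (by norm_num)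
  induction n with
  | zero =>
    intro i a
    have : (bisect 0 i a : QAlg N (Option (Fin N))).maxQueries ≤ 1 := by
      rw [bisect]
      split_ifs
      · simp [QAlg.maxQueries]
      · simp [QAlg.maxQueries]
    have : ((bisect 0 i a : QAlg N (Option (Fin N))).maxQueries : ℝ) ≤ 1 := by exact_mod_cast this
    have h0 : (0 : ℝ) ≤ i := by positivity
    simp only [pow_zero]
    linarith
  | succ n ih =>
    intro i a
    set M := max (bisect n (i + 1) a : QAlg N (Option (Fin N))).maxQueries
      (bisect n (i + 1) (a + 2 ^ n) : QAlg N (Option (Fin N))).maxQueries with hMdef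
    have hM : (M : ℝ) ≤ 36 * (i + 7) * √2 ^ n := by
      have h : ∀ a, _ := ih (i + 1)
      rw [hMdef, Nat.cast_max]
      refine max_le ((h a).trans_eq ?_) ((h _).trans_eq ?_) <;> (push_cast; ring)
    have h1 := maxQueries_searchWith_le (window a (2 ^ n))
      (fun b => if b then bisect n (i + 1) a else bisect n (i + 1) (a + 2 ^ n)) (M := M)
      (by rintro (_ | _); exacts [le_max_right _ _, le_max_left _ _])
      (List.replicate (3 * (i + 2)) (groverSchedule (Nat.clog 9 (2 ^ n)))).flatten
    set J := Nat.clog 9 (2 ^ n) with hJ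
    have h2 : (((List.replicate (3 * (i + 2)) (groverSchedule J)).flatten).map (· + 1)).sum =
        3 * (i + 2) * ((groverSchedule J).map (· + 1)).sum := by
      rw [List.map_flatten, List.sum_flatten]
      simp
    rw [h2] at h1
    have hsum := sum_groverSchedule_le J
    set q : ℕ := ((groverSchedule J).map (· + 1)).sum
    have h3 : (2 : ℝ) * q ≤ 3 * 3 ^ J := by exact_mod_cast hsum
    -- `9 ^ J` exceeds the size of the window by less than the factor `9`.
    have h4 : (3 : ℝ) ^ J ≤ 3 * √2 ^ n := by
      have h9 : 9 ^ J ≤ 9 * 2 ^ n := by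
        rcases Nat.eq_zero_or_pos J with h | h
        · rw [h]; have : 0 < 2 ^ n := by positivity
          omega
        · have := Nat.pow_lt_of_lt_clog (b := 9) (x := 2 ^ n) (y := J - 1)
            (by omega)
          obtain ⟨J', hJ'⟩ : ∃ J', J = J' + 1 := ⟨J - 1, by omega⟩
          rw [hJ'] at this ⊢
          rw [pow_succ]
          simp only [Nat.add_sub_cancel] at this
          omega
      have h9' : (9 : ℝ) ^ J ≤ 9 * 2 ^ n := by exact_mod_cast h9
      refine le_of_sq_le_sq (a := (3 : ℝ) ^ J) ?_ (by positivity)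
      rw [mul_pow, ← pow_mul, ← pow_mul, mul_comm J, mul_comm n, pow_mul, pow_mul,
        Real.sq_sqrt (by norm_num)]
      norm_num
      exact h9'
    have h1' : ((searchWith (window a (2 ^ n))
      (fun b => if b then bisect n (i + 1) a else bisect n (i + 1) (a + 2 ^ n))
      (List.replicate (3 * (i + 2)) (groverSchedule J)).flatten : QAlg N _).maxQueries : ℝ) ≤
        3 * (i + 2) * q + M := by exact_mod_cast h1
    refine h1'.trans ?_
    set s : ℝ := √2 ^ n with hsn
    have hs0 : 0 ≤ s := by positivity
    have hi : (0 : ℝ) ≤ i := by positivity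
    calc (3 : ℝ) * (i + 2) * q + M
        ≤ 3 * (i + 2) * (9 / 2 * s) + 36 * (i + 7) * s := by
          gcongr
          linarith
      _ ≤ 36 * (i + 6) * (s * (7 / 5)) := by nlinarith [mul_nonneg hi hs0]
      _ ≤ 36 * (i + 6) * (s * √2) := by gcongr
      _ = 36 * (i + 6) * √2 ^ (n + 1) := by rw [pow_succ]

/-- First-one search with `O(√N)` queries in the worst case. -/
theorem exists_firstOneSearch : ∃ c : ℝ, ∀ N : ℕ, 1 ≤ N → ∃ F : QAlg N (Option (Fin N)),
    IsFirstOneSearch F ∧ (F.maxQueries : ℝ) ≤ c * √(N : ℝ) := by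
  refine ⟨36 * 6 * 2, fun N hN => ?_⟩
  have : NeZero N := ⟨by omega⟩
  refine ⟨bisect (Nat.clog 2 N) 0 0, fun f => ?_, (maxQueries_bisect_le _ _ _).trans ?_⟩
  · have h := le_dist_bisect f (Nat.clog 2 N) 0 0 (fun j hj => by omega) (by
      by_cases h : ∃ j, f j
      · obtain ⟨j, hj⟩ := h
        refine Or.inr ⟨j, hj, ?_⟩
        have := Nat.le_pow_clog (b := 2) (by norm_num) N
        omega
      · push Not at h
        exact Or.inl fun j => by simpa using h j)
    simpa using h
  · have h : √2 ^ Nat.clog 2 N ≤ 2 * √(N : ℝ) := by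
      have h2 : 2 ^ Nat.clog 2 N ≤ 2 * N := by
        rcases Nat.eq_zero_or_pos (Nat.clog 2 N) with h | h
        · rw [h]; omega
        · obtain ⟨J', hJ'⟩ : ∃ J', Nat.clog 2 N = J' + 1 := ⟨Nat.clog 2 N - 1, by omega⟩
          have := Nat.pow_lt_of_lt_clog (b := 2) (x := N) (y := J') (by omega)
          rw [hJ', pow_succ]
          omega
      have h2' : (2 : ℝ) ^ Nat.clog 2 N ≤ 2 * N := by exact_mod_cast h2
      refine le_of_sq_le_sq (a := √2 ^ Nat.clog 2 N) ?_ (by positivity)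
      rw [mul_pow, Real.sq_sqrt (by positivity), ← pow_mul, mul_comm _ 2, pow_mul,
        Real.sq_sqrt (by norm_num)]
      have : (0 : ℝ) ≤ N := by positivity
      linarith
    simp only [Nat.cast_zero, zero_add]
    linarith

end Search

/-! ### AVL trees and search trees -/

section TreeLemmas

open BinaryTree

variable {α : Type}

/-- The values of a tree from left to right. -/
def inorder : BinaryTree α → List α
  | nil => []
  | node v l r => inorder l ++ v :: inorder r

/-- The balance condition of AVL trees. -/
def IsAVL : BinaryTree α → Prop
  | nil => True
  | node _ l r => IsAVL l ∧ IsAVL r ∧ l.height ≤ r.height + 1 ∧ r.height ≤ l.height + 1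

theorem length_inorder (t : BinaryTree α) : (inorder t).length = t.numNodes := by
  induction t with
  | nil => rfl
  | node v l r hl hr => simp [inorder, hl, hr]; omega

theorem IsAVL.two_pow_height_le {t : BinaryTree α} (h : IsAVL t) :
    2 ^ t.height ≤ (t.numNodes + 1) ^ 2 := by
  induction t with
  | nil => simp
  | node v l r hl hr =>
    obtain ⟨h1, h2, h3, h4⟩ := h
    have hl := hl h1
    have hr := hr h2
    have key : ∀ a b A : ℕ, A ≤ 2 * a ^ 2 → A ≤ b ^ 2 → A * 2 ≤ (a + b) ^ 2 := by
      intro a b A ha hb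
      rcases le_total a b with h | h <;> nlinarith [Nat.mul_le_mul h h, Nat.mul_le_mul_left a h]
    simp only [height, numNodes]
    rcases le_total l.height r.height with hlr | hlr
    · rw [max_eq_right hlr, pow_succ]
      have : 2 ^ r.height ≤ 2 * 2 ^ l.height := by
        rw [← pow_succ']; exact Nat.pow_le_pow_right (by norm_num) h4
      convert key (l.numNodes + 1) (r.numNodes + 1) _ (by omega) hr using 2
      ring
    · rw [max_eq_left hlr, pow_succ]
      have : 2 ^ l.height ≤ 2 * 2 ^ r.height := by
        rw [← pow_succ']; exact Nat.pow_le_pow_right (by norm_num) h3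
      convert key (r.numNodes + 1) (l.numNodes + 1) _ (by omega) hl using 2
      ring

theorem inorder_avlNode (v : α) (l r : BinaryTree α) :
    inorder (avlNode v l r) = inorder l ++ v :: inorder r := by
  unfold avlNode
  split_ifs
  · split
    · split_ifs <;> simp [inorder]
    · simp [inorder]
    · simp [inorder]
  · split
    · split_ifs <;> simp [inorder]
    · simp [inorder]
    · simp [inorder]
  · rfl

/-- Rebalancing restores the AVL condition, and the height is the larger height of the subtrees or one
more. -/
theorem IsAVL.avlNode {v : α} {l r : BinaryTree α} (hl : IsAVL l) (hr : IsAVL r)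
    (h1 : l.height ≤ r.height + 2) (h2 : r.height ≤ l.height + 2) :
    IsAVL (QBuffer.avlNode v l r) ∧
      max l.height r.height ≤ (QBuffer.avlNode v l r).height ∧
      (QBuffer.avlNode v l r).height ≤ max l.height r.height + 1 ∧
      (l.height ≤ r.height + 1 → r.height ≤ l.height + 1 →
        (QBuffer.avlNode v l r).height = max l.height r.height + 1) := by
  unfold QBuffer.avlNode
  split_ifs with c1 c2
  · split
    · split_ifs <;> simp only [IsAVL, height] at * <;> grind
    · simp only [IsAVL, height] at *; grind
    · simp only [IsAVL, height] at *; grind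
  · split
    · split_ifs <;> simp only [IsAVL, height] at * <;> grind
    · simp only [IsAVL, height] at *; grind
    · simp only [IsAVL, height] at *; grind
  · simp only [IsAVL, height] at *; grind

variable {d k : ℕ}

theorem IsAVL.addVertex {t : BinaryTree (Vertex d k)} (v : Vertex d k) (h : IsAVL t) :
    IsAVL (addVertex v t) ∧ t.height ≤ (addVertex v t).height ∧
      (addVertex v t).height ≤ t.height + 1 := by
  induction t with
  | nil => simp [QBuffer.addVertex, IsAVL]
  | node u l r hl hr =>
    obtain ⟨h1, h2, h3, h4⟩ := h
    have hl := hl h1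
    have hr := hr h2
    simp only [QBuffer.addVertex]
    split_ifs
    · have := IsAVL.avlNode (v := u) hl.1 h2 (by omega) (by omega)
      simp only [height]
      refine ⟨this.1, ?_, ?_⟩ <;> omega
    · have := IsAVL.avlNode (v := u) h1 hr.1 (by omega) (by omega)
      simp only [height]
      refine ⟨this.1, ?_, ?_⟩ <;> omega
    · exact ⟨⟨h1, h2, h3, h4⟩, le_rfl, Nat.le_succ _⟩

/-- The keys increase strictly from left to right. -/
def IsSearchTree (t : BinaryTree (Vertex d k)) : Prop :=
  (inorder t).Pairwise fun u v => toLex u.key < toLex v.key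

theorem isSearchTree_node {v : Vertex d k} {l r : BinaryTree (Vertex d k)} :
    IsSearchTree (node v l r) ↔ IsSearchTree l ∧ IsSearchTree r ∧
      (∀ u ∈ inorder l, toLex u.key < toLex v.key) ∧
      (∀ u ∈ inorder r, toLex v.key < toLex u.key) := by
  simp only [IsSearchTree, inorder, List.pairwise_append, List.pairwise_cons, List.mem_cons]
  constructor
  · rintro ⟨h1, ⟨h2, h3⟩, h4⟩
    exact ⟨h1, h3, fun u hu => h4 u hu v (Or.inl rfl), h2⟩
  · rintro ⟨h1, h2, h3, h4⟩
    refine ⟨h1, ⟨h4, h2⟩, fun u hu w hw => ?_⟩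
    rcases hw with rfl | hw
    · exact h3 u hu
    · exact (h3 u hu).trans (h4 w hw)

theorem isSearchTree_avlNode {v : Vertex d k} {l r : BinaryTree (Vertex d k)} :
    IsSearchTree (avlNode v l r) ↔ IsSearchTree (node v l r) := by
  rw [IsSearchTree, inorder_avlNode]
  rfl

theorem length_inorder_addVertex_le (v : Vertex d k) (t : BinaryTree (Vertex d k)) :
    (inorder (addVertex v t)).length ≤ (inorder t).length + 1 := by
  induction t with
  | nil => simp [addVertex, inorder]
  | node u l r hl hr =>
    simp only [addVertex]
    split_ifs
    · rw [inorder_avlNode]; simp only [inorder, List.length_append, List.length_cons]; omega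
    · rw [inorder_avlNode]; simp only [inorder, List.length_append, List.length_cons]; omega
    · omega

theorem IsSearchTree.addVertex {t : BinaryTree (Vertex d k)} (v : Vertex d k)
    (h : IsSearchTree t) : IsSearchTree (addVertex v t) ∧
      ∀ u, u ∈ inorder (addVertex v t) ↔
        u ∈ inorder t ∨ (u = v ∧ ∀ w ∈ inorder t, w.key ≠ v.key) := by
  induction t with
  | nil => simp [QBuffer.addVertex, IsSearchTree, inorder]
  | node u l r hl hr =>
    obtain ⟨h1, h2, h3, h4⟩ := isSearchTree_node.1 h
    obtain ⟨hl, hl'⟩ := hl h1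
    obtain ⟨hr, hr'⟩ := hr h2
    simp only [QBuffer.addVertex]
    split_ifs with c1 c2
    · rw [isSearchTree_avlNode, isSearchTree_node, inorder_avlNode]
      refine ⟨⟨hl, h2, fun w hw => ?_, h4⟩, fun w => ?_⟩
      · rcases (hl' w).1 hw with hw | ⟨rfl, -⟩
        · exact h3 w hw
        · exact c1
      · have hne : ∀ w ∈ u :: inorder r, w.key ≠ v.key := by
          intro w hw e
          rcases List.mem_cons.1 hw with rfl | hw
          · exact absurd (e ▸ c1) (lt_irrefl _)
          · exact absurd (e ▸ (c1.trans (h4 w hw))) (lt_irrefl _)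
        simp only [inorder, List.mem_append, hl']
        grind
    · rw [isSearchTree_avlNode, isSearchTree_node, inorder_avlNode]
      refine ⟨⟨h1, hr, h3, fun w hw => ?_⟩, fun w => ?_⟩
      · rcases (hr' w).1 hw with hw | ⟨rfl, -⟩
        · exact h4 w hw
        · exact c2
      · have hne : ∀ w ∈ inorder l, w.key ≠ v.key := fun w hw e =>
          absurd (e ▸ ((h3 w hw).trans c2)) (lt_irrefl _)
        have hne' : u.key ≠ v.key := fun e => absurd (e ▸ c2) (lt_irrefl _)
        simp only [inorder, List.mem_append, List.mem_cons, hr']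
        grind
    · have e : u.key = v.key := toLex.injective (le_antisymm (not_lt.1 c1) (not_lt.1 c2))
      refine ⟨h, fun w => ⟨Or.inl, ?_⟩⟩
      rintro (hw | ⟨-, hw⟩)
      · exact hw
      · exact absurd e (hw u (by simp [inorder]))

theorem inorder_map {β : Type} (g : α → β) (t : BinaryTree α) :
    inorder (t.map g) = (inorder t).map g := by
  induction t with
  | nil => rfl
  | node v l r hl hr => simp [BinaryTree.map, inorder, hl, hr]

theorem height_map {β : Type} (g : α → β) (t : BinaryTree α) : (t.map g).height = t.height := by
  induction t with
  | nil => rfl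
  | node v l r hl hr => simp [BinaryTree.map, hl, hr]

theorem IsSearchTree.incr {t : BinaryTree (Vertex d k)} (h : IsSearchTree t) (i : Fin d) :
    IsSearchTree (incr i t) := by
  rw [IsSearchTree, QBuffer.incr, inorder_map, List.pairwise_map]
  refine List.Pairwise.imp ?_ h
  intro u v huv
  split_ifs <;> exact huv

theorem mem_inorder_incr {t : BinaryTree (Vertex d k)} {i : Fin d} {u : Vertex d k} :
    u ∈ inorder (incr i t) ↔
      ∃ v ∈ inorder t, (if v.idx = i then { v with count := v.count + 1 } else v) = u := by
  rw [incr, inorder_map, List.mem_map]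

/-- The lexicographical order of `x` relative to `s`, read off from the first mismatch as in the
comparison of strings by quantum search. -/
def lexCompare (s x : Fin k → Bool) : Ordering :=
  match firstOne fun j => xor (x j) (s j) with
  | none => .eq
  | some j => if s j then .lt else .gt

theorem lexCompare_spec (s x : Fin k → Bool) :
    (lexCompare s x = .lt → toLex x < toLex s) ∧ (lexCompare s x = .gt → toLex s < toLex x) ∧
      (lexCompare s x = .eq → x = s) := by
  unfold lexCompare
  cases h : firstOne fun j => xor (x j) (s j) with
  | none =>
    rw [firstOne_eq_none] at h
    refine ⟨nofun, nofun, fun _ => funext fun j => by simpa using h j⟩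
  | some j =>
    obtain ⟨hj, hlt⟩ := firstOne_eq_some.1 h
    have hlt' : ∀ i < j, x i = s i := fun i hi => by simpa using hlt i hi
    by_cases hs : s j = true
    · have hx : x j = false := by simpa [hs] using hj
      simp only [hs, if_true]
      refine ⟨fun _ => ⟨j, hlt', ?_⟩, nofun, nofun⟩
      simp [hs, hx]
    · have hs : s j = false := by simpa using hs
      have hx : x j = true := by simpa [hs] using hj
      simp only [hs]
      refine ⟨nofun, fun _ => ⟨j, fun i hi => (hlt' i hi).symm, ?_⟩, nofun⟩
      simp [hs, hx]

/-- The result of an errorless search for the key `x`. -/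
def lookup (x : Fin k → Bool) : BinaryTree (Vertex d k) → Option (Vertex d k)
  | nil => none
  | node v l r =>
    match lexCompare v.key x with
    | .lt => lookup x l
    | .gt => lookup x r
    | .eq => some v

theorem lookup_eq_some {x : Fin k → Bool} {t : BinaryTree (Vertex d k)} {v : Vertex d k}
    (h : lookup x t = some v) : v ∈ inorder t ∧ v.key = x := by
  induction t with
  | nil => simp [lookup] at h
  | node u l r hl hr =>
    have hs := lexCompare_spec u.key x
    rw [lookup] at h
    simp only [inorder, List.mem_append, List.mem_cons]
    cases hc : lexCompare u.key x <;> rw [hc] at h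
    · exact ⟨Or.inl (hl h).1, (hl h).2⟩
    · obtain rfl : u = v := by simpa using h
      exact ⟨by simp, (hs.2.2 hc).symm⟩
    · exact ⟨Or.inr (Or.inr (hr h).1), (hr h).2⟩

theorem lookup_eq_none {x : Fin k → Bool} {t : BinaryTree (Vertex d k)} (ht : IsSearchTree t)
    (h : lookup x t = none) : ∀ v ∈ inorder t, v.key ≠ x := by
  induction t with
  | nil => simp [inorder]
  | node u l r hl hr =>
    obtain ⟨h1, h2, h3, h4⟩ := isSearchTree_node.1 ht
    have hs := lexCompare_spec u.key x
    rw [lookup] at h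
    intro v hv
    simp only [inorder, List.mem_append, List.mem_cons] at hv
    cases hc : lexCompare u.key x <;> rw [hc] at h
    · have hlt := hs.1 hc
      rintro rfl
      rcases hv with hv | rfl | hv
      · exact hl h1 h v hv rfl
      · exact lt_irrefl _ hlt
      · exact lt_irrefl _ (hlt.trans (h4 v hv))
    · simp at h
    · have hlt := hs.2.1 hc
      rintro rfl
      rcases hv with hv | rfl | hv
      · exact lt_irrefl _ (hlt.trans (h3 v hv))
      · exact lt_irrefl _ hlt
      · exact hr h2 h v hv rfl

end TreeLemmas

/-! ### The time until the answer is settled -/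

section Game

variable {n k : ℕ} {Y : Type} {I : Fin n → Bool} {y₀ : Y}

/-- The probability that the program (started with current answer `y`, after `l` loads, with load
flag `b`) gives the answer `y₀` whenever it is asked after `τ` or more rounds. -/
noncomputable def settleProb (I : Fin n → Bool) (y₀ : Y) (p : Prog k Y) (y : Y) (l : ℕ) (b : Bool) (τ : ℕ) :
    ℝ≥0∞ :=
  (p.answers I y l b).toOuterMeasure {g | ∀ t, τ ≤ t → g t = y₀}

theorem settleProb_mono (p : Prog k Y) (y : Y) (l : ℕ) (b : Bool) {τ τ' : ℕ} (h : τ ≤ τ') :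
    settleProb I y₀ p y l b τ ≤ settleProb I y₀ p y l b τ' :=
  MeasureTheory.measure_mono fun _ hg t ht => hg t (h.trans ht)

theorem le_toOuterMeasure_map_delay (μ : PMF (ℕ → Y)) (T : ℕ) (y : Y) (τ : ℕ) :
    μ.toOuterMeasure {g | ∀ t, τ ≤ t → g t = y₀} ≤
      (μ.map (delay T y)).toOuterMeasure {g | ∀ t, τ + T ≤ t → g t = y₀} := by
  rw [PMF.toOuterMeasure_map_apply]
  refine MeasureTheory.measure_mono fun g hg t ht => ?_
  rw [delay, if_neg (by omega)]
  exact hg _ (by omega)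

theorem settleProb_halt (l : ℕ) (b : Bool) (τ : ℕ) :
    settleProb I y₀ (.halt : Prog k Y) y₀ l b τ = 1 := by
  rw [settleProb, Prog.answers, PMF.toOuterMeasure_pure_apply, if_pos]
  exact fun _ _ => rfl

theorem settleProb_output (p : Prog k Y) (y y' : Y) (l : ℕ) (b : Bool) (τ : ℕ) :
    settleProb I y₀ (.output y' p) y l b τ = settleProb I y₀ p y' l b τ := rfl

theorem le_settleProb_load (p : Prog k Y) (y : Y) (l : ℕ) (b : Bool) (τ : ℕ) :
    settleProb I y₀ p y (l + 1) true τ ≤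
      settleProb I y₀ (.load p) y l b (τ + if b then 1 else 0) :=
  le_toOuterMeasure_map_delay _ _ _ _

theorem le_settleProb_query (C : Circuit k) (next : Basis k C.w → Prog k Y) (y : Y) (l : ℕ)
    (b : Bool) (τ : ℕ) :
    ∑' z, C.dist (buffer k I l) z *
        settleProb I y₀ (next z) y l (if C.T = 0 then b else false) τ ≤
      settleProb I y₀ (.query C next) y l b (τ + C.T) := by
  rw [settleProb, Prog.answers, PMF.toOuterMeasure_bind_apply]
  refine ENNReal.tsum_le_tsum fun z => ?_
  gcongr
  exact le_toOuterMeasure_map_delay _ _ _ _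

theorem le_settleProb_request (q : Fin k) (cont : Bool → Prog k Y) (y : Y) (l : ℕ)
    (b : Bool) (τ : ℕ) :
    settleProb I y₀ (cont (buffer k I l q)) y l false τ ≤
      settleProb I y₀ (request q cont) y l b (τ + 1) := by
  refine le_trans ?_ (le_settleProb_query _ _ _ _ _ _)
  rw [Circuit.dist_read]
  refine le_trans ?_ (ENNReal.le_tsum (q, buffer k I l q, 0))
  simp

theorem le_settleProb_readBits (cont : (Fin k → Bool) → Prog k Y) (y : Y) (l : ℕ) (τ : ℕ)
    (qs : List (Fin k)) : ∀ (acc : Fin k → Bool) (b : Bool), (qs = [] → b = false) →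
    settleProb I y₀ (cont fun q => if q ∈ qs then buffer k I l q else acc q) y l false τ ≤
      settleProb I y₀ (readBits qs acc cont) y l b (τ + qs.length) := by
  induction qs with
  | nil =>
    intro acc b hb
    rw [hb rfl]
    simp [readBits]
  | cons q qs ih =>
    intro acc b _
    refine le_trans ?_ (le_settleProb_request _ _ _ _ _ _)
    refine le_trans (le_of_eq ?_) (ih _ _ fun _ => rfl)
    congr 2
    ext q'
    by_cases h1 : q' ∈ qs <;> by_cases h2 : q' = q <;> simp [h1, h2]

/-- The first phase takes exactly `k` rounds for each keyword: the load happens in the round of the first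
query. -/
theorem le_settleProb_readKeywords [NeZero k] {d : ℕ} (cont : BinaryTree (Vertex d k) → Prog k Y)
    (key : Fin d → Fin k → Bool) (y : Y) (τ : ℕ) (js : List (Fin d)) :
    ∀ (t : BinaryTree (Vertex d k)) (l : ℕ),
    (∀ i (h : i < js.length), buffer k I (l + i + 1) = key js[i]) →
    settleProb I y₀ (cont (js.foldl (fun t j => addVertex ⟨j, key j, 0⟩ t) t)) y
        (l + js.length) false τ ≤
      settleProb I y₀ (readKeywords cont js t) y l false (τ + js.length * k) := by
  induction js with
  | nil =>
    intro t l _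
    simp [readKeywords]
  | cons j js ih =>
    intro t l h
    have hlen : (List.finRange k).length = k := List.length_finRange
    have hk : 0 < k := Nat.pos_of_ne_zero (NeZero.ne k)
    have hload := fun p : Prog k Y => le_settleProb_load (I := I) (y₀ := y₀) p y l false
      (τ + (j :: js).length * k)
    simp only [Bool.false_eq_true, if_false, add_zero] at hload
    refine le_trans ?_ (hload _)
    have e : τ + (j :: js).length * k = τ + js.length * k + (List.finRange k).length := by
      rw [hlen, List.length_cons]; ring
    rw [e]
    refine le_trans ?_ (le_settleProb_readBits _ _ _ _ _ _ _ fun h0 => by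
      rw [h0] at hlen; simp at hlen; omega)
    have hb : (fun q => if q ∈ List.finRange k then buffer k I (l + 1) q else false) = key j := by
      have := h 0 (by simp)
      simp only [List.getElem_cons_zero, add_zero] at this
      ext q
      simp [this]
    rw [hb]
    refine le_trans (le_of_eq ?_) (ih _ _ fun i hi => ?_)
    · rw [List.length_cons, List.foldl_cons]
      congr 1
      omega
    · have := h (i + 1) (by simpa using hi)
      simp only [List.getElem_cons_succ] at this
      rw [← this]
      congr 1
      omega

/-- The search for a mismatch has the distribution of the search algorithm on the function that marks the
mismatches. -/
theorem le_settleProb_searchMismatch {Out : Type} (s : Fin k → Bool) (F : QAlg k Out)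
    (cont : Out → Prog k Y) (y : Y) (l : ℕ) (τ : ℕ) (a : Out → ℝ≥0∞)
    (ha : ∀ o b, a o ≤ settleProb I y₀ (cont o) y l b τ) : ∀ b : Bool,
    ∑' o, F.dist (fun i => xor (buffer k I l i) (s i)) o * a o ≤
      settleProb I y₀ (searchMismatch s F cont) y l b (τ + F.maxQueries) := by
  classical
  induction F with
  | ret o =>
    intro b
    refine le_trans (le_of_eq ?_) (ha o b)
    rw [QAlg.dist, tsum_eq_single o]
    · simp
    · intro o' ho'
      simp [ho']
  | run C next ih =>
    intro b
    rw [QAlg.maxQueries, add_comm C.T, ← add_assoc]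
    refine le_trans ?_ (le_settleProb_query (C.mask s) _ _ _ _ _)
    rw [Circuit.dist_mask]
    simp only [QAlg.dist, PMF.bind_apply, ← ENNReal.tsum_mul_right]
    rw [ENNReal.tsum_comm]
    refine ENNReal.tsum_le_tsum fun z => ?_
    simp only [mul_assoc]
    rw [ENNReal.tsum_mul_left]
    gcongr
    exact (ih z _).trans (settleProb_mono _ _ _ _
      (Nat.add_le_add_left (Finset.le_sup (f := fun z => (next z).maxQueries) (Finset.mem_univ z)) _))

variable {F : QAlg k (Option (Fin k))}

/-- Once the smallest mismatch has been found, the result of a comparison is right with certainty: a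
position that passes the check is a mismatch, so it does not come before the first one. -/
theorem le_settleProb_compareStrings_of_eq (s : Fin k → Bool) (cont : Ordering → Prog k Y) (y : Y)
    (l : ℕ) (τ : ℕ) {a : ℝ≥0∞}
    (ha : ∀ b, a ≤ settleProb I y₀ (cont (lexCompare s (buffer k I l))) y l b τ) (r : ℕ) :
    ∀ b, a ≤ settleProb I y₀ (compareStrings F s cont r
      (firstOne fun i => xor (buffer k I l i) (s i))) y l b (τ + r * (F.maxQueries + 1)) := by
  set x := buffer k I l with hx
  induction r with
  | zero =>
    intro b
    have h := ha b
    rw [lexCompare] at h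
    simp only [zero_mul, add_zero]
    cases hf : firstOne (fun i => xor (x i) (s i)) <;> rw [hf] at h <;> exact h
  | succ r ih =>
    intro b
    rw [show τ + (r + 1) * (F.maxQueries + 1) =
      τ + r * (F.maxQueries + 1) + 1 + F.maxQueries by ring]
    refine le_trans (le_tsum_mul_of_forall_le _ fun _ => le_rfl)
      (le_settleProb_searchMismatch s F _ y l _ (fun _ => a) (fun o b => ?_) b)
    cases o with
    | none => exact (ih b).trans (settleProb_mono _ _ _ _ (Nat.le_succ _))
    | some j =>
      refine le_trans ?_ (le_settleProb_request _ _ _ _ _ _)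
      rw [← hx]
      by_cases hj : x j = s j
      · rw [if_neg (by simpa using hj)]
        exact ih _
      · rw [if_pos hj]
        cases hf : firstOne (fun i => xor (x i) (s i)) with
        | none =>
          exact absurd (by simpa using firstOne_eq_none.1 hf j) hj
        | some j₀ =>
          have hle : j₀ ≤ j := by
            by_contra hlt
            exact hj (by simpa using (firstOne_eq_some.1 hf).2 j (not_le.1 hlt))
          rw [Option.elim_some, min_eq_right hle, ← hf]
          exact ih _

/-- Each run of the search finds the first mismatch with probability at least `1 / 2`. -/
theorem le_settleProb_compareStrings (hF : IsFirstOneSearch F) (s : Fin k → Bool)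
    (cont : Ordering → Prog k Y) (y : Y) (l : ℕ) (τ : ℕ) {a : ℝ≥0∞}
    (ha : ∀ b, a ≤ settleProb I y₀ (cont (lexCompare s (buffer k I l))) y l b τ) (r : ℕ) :
    ∀ b best, (∀ j, best = some j → buffer k I l j ≠ s j) →
      (1 - (1 / 2) ^ r) * a ≤ settleProb I y₀ (compareStrings F s cont r best) y l b
        (τ + r * (F.maxQueries + 1)) := by
  have key := le_settleProb_compareStrings_of_eq (F := F) s cont y l τ ha
  have hF := hF fun i => xor (buffer k I l i) (s i)
  set x := buffer k I l with hx
  have hle : ∀ r : ℕ, (1 - (1 / 2) ^ r) * a ≤ a := fun r => mul_le_of_le_one_left' tsub_le_self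
  induction r with
  | zero => intro b best _; simp
  | succ r ih =>
    intro b best hbest
    cases hf : firstOne (fun i => xor (x i) (s i)) with
    | none =>
      have hnone : best = none := by
        rw [Option.eq_none_iff_forall_ne_some]
        intro j hj
        exact hbest j hj (by simpa using firstOne_eq_none.1 hf j)
      rw [hnone, ← hf]
      exact (hle _).trans (key _ b)
    | some j₀ =>
      obtain ⟨hj₀, hmin⟩ := firstOne_eq_some.1 hf
      rw [show τ + (r + 1) * (F.maxQueries + 1) =
        τ + r * (F.maxQueries + 1) + 1 + F.maxQueries by ring]
      refine le_trans ?_ (le_settleProb_searchMismatch s F _ y l _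
        (fun o => if o = some j₀ then a else (1 - (1 / 2) ^ r) * a) (fun o b => ?_) b)
      · rw [hf] at hF
        have := le_tsum_mul_of_le_tsum_indicator (F.dist fun i => xor (x i) (s i)) {some j₀} (p := 1 / 2)
          (ε := (1 / 2) ^ r) (a := a)
          (v := fun o => if o = some j₀ then a else (1 - (1 / 2) ^ r) * a) (by simp)
          (pow_le_one' (by simp) _) ?_ ?_ ?_
        · rwa [one_div, ENNReal.one_sub_inv_two, ← one_div, ← pow_succ'] at this
        · refine hF.trans (le_trans (le_of_eq ?_) (ENNReal.le_tsum (some j₀)))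
          simp
        · intro o
          split_ifs
          · exact hle r
          · exact le_rfl
        · rintro o rfl
          simp
      · cases o with
        | none =>
          rw [if_neg (by simp)]
          exact (ih b best hbest).trans (settleProb_mono _ _ _ _ (Nat.le_succ _))
        | some j =>
          refine le_trans ?_ (le_settleProb_request _ _ _ _ _ _)
          rw [← hx]
          by_cases hj : x j = s j
          · have hne : some j ≠ some j₀ := by
              rintro ⟨⟩
              simp [hj] at hj₀
            rw [if_neg hne, if_neg (by simpa using hj)]
            exact ih _ _ hbest
          · rw [if_pos hj]
            split_ifs with h
            · obtain rfl : j = j₀ := by simpa using h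
              have : best.elim j (min j) = j := by
                cases best with
                | none => rfl
                | some i =>
                  refine min_eq_left (not_lt.1 fun hlt => hbest i rfl ?_)
                  simpa using hmin i hlt
              rw [this, ← hf]
              exact key r _
            · refine ih _ _ fun i hi => ?_
              obtain rfl : best.elim j (min j) = i := by simpa using hi
              cases best with
              | none => exact hj
              | some i' =>
                rcases min_choice j i' with h' | h'
                · simpa [h'] using hj
                · simpa [h'] using hbest i' rfl

/-- A search in the tree is right if the at most `t.height` comparisons on its path are. -/
theorem le_settleProb_findVertex (hF : IsFirstOneSearch F) {d : ℕ} (reps : ℕ)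
    (cont : Option (Vertex d k) → Prog k Y) (y : Y) (l : ℕ) (τ : ℕ) {a : ℝ≥0∞}
    (t : BinaryTree (Vertex d k))
    (ha : ∀ b, a ≤ settleProb I y₀ (cont (lookup (buffer k I l) t)) y l b τ) : ∀ b,
    (1 - (1 / 2) ^ reps) ^ t.height * a ≤ settleProb I y₀ (findVertex F reps cont t) y l b
      (τ + t.height * (reps * (F.maxQueries + 1))) := by
  set q : ℝ≥0∞ := 1 - (1 / 2) ^ reps with hq
  have hq1 : q ≤ 1 := tsub_le_self
  set M := reps * (F.maxQueries + 1) with hM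
  induction t with
  | nil => intro b; simpa [findVertex, lookup] using ha b
  | node v tl tr ihl ihr =>
    intro b
    let c : Ordering → Prog k Y := fun
      | .lt => findVertex F reps cont tl
      | .gt => findVertex F reps cont tr
      | .eq => cont (some v)
    have step : ∀ b, q ^ (max tl.height tr.height) * a ≤
        settleProb I y₀ (c (lexCompare v.key (buffer k I l))) y l b
          (τ + max tl.height tr.height * M) := by
      intro b
      rw [lookup] at ha
      cases hc : lexCompare v.key (buffer k I l) <;> rw [hc] at ha
      · refine le_trans ?_ ((ihl ha b).trans (settleProb_mono _ _ _ _ ?_))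
        · gcongr ?_ * _
          exact pow_le_pow_right_of_le_one' hq1 (le_max_left _ _)
        · gcongr
          exact le_max_left _ _
      · refine le_trans (mul_le_of_le_one_left' (pow_le_one' hq1 _)) ((ha b).trans
          (settleProb_mono _ _ _ _ (Nat.le_add_right _ _)))
      · refine le_trans ?_ ((ihr ha b).trans (settleProb_mono _ _ _ _ ?_))
        · gcongr ?_ * _
          exact pow_le_pow_right_of_le_one' hq1 (le_max_right _ _)
        · gcongr
          exact le_max_right _ _
    have h := le_settleProb_compareStrings hF v.key c y l _ step reps b none nofun
    rw [BinaryTree.height, pow_succ', mul_assoc]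
    refine h.trans (settleProb_mono _ _ _ _ (le_of_eq ?_))
    rw [← hM]
    ring

end Game

/-! ### Counting the keywords -/

section Counting

variable {d k : ℕ}

/-- The number of occurrences of `s` among the first `j` terms of a sequence of words. -/
def occ (w : ℕ → Fin k → Bool) (j : ℕ) (s : Fin k → Bool) : ℕ :=
  ((Finset.range j).filter fun i => w i = s).card

theorem occ_succ (w : ℕ → Fin k → Bool) (j : ℕ) (s : Fin k → Bool) :
    occ w (j + 1) s = occ w j s + if w j = s then 1 else 0 := by
  rw [occ, Finset.range_add_one, Finset.filter_insert]
  split_ifs with h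
  · rw [Finset.card_insert_of_notMem (by simp)]
    rfl
  · rfl

/-- The state of an errorless run after `j` words: the tree has one vertex for each distinct keyword,
with its smallest index and its number of occurrences, `cmax` is the maximal number of occurrences
and `imax` is the smallest index of a keyword that has it. -/
structure CountInv (key : Fin d → Fin k → Bool) (w : ℕ → Fin k → Bool) (j : ℕ)
    (t : BinaryTree (Vertex d k)) (cmax : ℕ) (imax : Fin d) : Prop where
  search : IsSearchTree t
  vertex : ∀ v ∈ inorder t,
    key v.idx = v.key ∧ (∀ i, key i = v.key → v.idx ≤ i) ∧ v.count = occ w j v.key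
  exists_vertex : ∀ i, ∃ v ∈ inorder t, v.key = key i
  le_max : ∀ i, occ w j (key i) ≤ cmax
  eq_max : occ w j (key imax) = cmax
  le_of_eq_max : ∀ i, occ w j (key i) = cmax → imax ≤ i

variable {key : Fin d → Fin k → Bool} {w : ℕ → Fin k → Bool} {j : ℕ}
  {t : BinaryTree (Vertex d k)} {cmax : ℕ} {imax : Fin d}

theorem CountInv.succ_of_none (h : CountInv key w j t cmax imax) (hl : lookup (w j) t = none) :
    CountInv key w (j + 1) t cmax imax := by
  have hne := lookup_eq_none h.search hl
  have hocc : ∀ v ∈ inorder t, occ w (j + 1) v.key = occ w j v.key := fun v hv => by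
    rw [occ_succ, if_neg fun e => hne v hv e.symm, add_zero]
  have hocc' : ∀ i, occ w (j + 1) (key i) = occ w j (key i) := fun i => by
    obtain ⟨v, hv, e⟩ := h.exists_vertex i
    rw [← e]
    exact hocc v hv
  refine ⟨h.search, fun v hv => ?_, h.exists_vertex, ?_, ?_, ?_⟩
  · rw [hocc v hv]
    exact h.vertex v hv
  · simpa only [hocc'] using h.le_max
  · simpa only [hocc'] using h.eq_max
  · simpa only [hocc'] using h.le_of_eq_max

theorem CountInv.incr_of_some (h : CountInv key w j t cmax imax) {v : Vertex d k}
    (hl : lookup (w j) t = some v) :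
    if cmax < v.count + 1 ∨ (v.count + 1 = cmax ∧ v.idx < imax) then
      CountInv key w (j + 1) (incr v.idx t) (v.count + 1) v.idx
    else CountInv key w (j + 1) (incr v.idx t) cmax imax := by
  obtain ⟨hv, hkey⟩ := lookup_eq_some hl
  obtain ⟨hv1, hv2, hv3⟩ := h.vertex v hv
  have hvert : ∀ u ∈ inorder (incr v.idx t),
      key u.idx = u.key ∧ (∀ i, key i = u.key → u.idx ≤ i) ∧ u.count = occ w (j + 1) u.key := by
    intro u hu
    obtain ⟨u', hu', rfl⟩ := mem_inorder_incr.1 hu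
    obtain ⟨h1, h2, h3⟩ := h.vertex u' hu'
    split_ifs with e
    · refine ⟨h1, h2, ?_⟩
      have : w j = u'.key := by rw [← hkey, ← hv1, ← e, h1]
      simp only [occ_succ, if_pos this, h3]
    · refine ⟨h1, h2, ?_⟩
      have : w j ≠ u'.key := fun e' => e <| by
        have e1 : v.key = u'.key := hkey.trans e'
        exact le_antisymm (h2 _ (hv1.trans e1)) (hv2 _ (h1.trans e1.symm))
      rw [occ_succ, if_neg this, h3, add_zero]
  have hex : ∀ i, ∃ u ∈ inorder (incr v.idx t), u.key = key i := by
    intro i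
    obtain ⟨u, hu, e⟩ := h.exists_vertex i
    refine ⟨_, mem_inorder_incr.2 ⟨u, hu, rfl⟩, ?_⟩
    split_ifs <;> exact e
  have hocc : ∀ i, key i = v.key → occ w (j + 1) (key i) = v.count + 1 := fun i e => by
    rw [occ_succ, e, if_pos hkey.symm, hv3]
  have hocc' : ∀ i, key i ≠ v.key → occ w (j + 1) (key i) = occ w j (key i) := fun i e => by
    rw [occ_succ, if_neg fun e' => e (e'.symm.trans hkey.symm), add_zero]
  have hle : v.count ≤ cmax := by rw [hv3, ← hv1]; exact h.le_max _
  split_ifs with hc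
  · refine ⟨h.search.incr _, hvert, hex, fun i => ?_, hocc _ hv1, fun i hi => ?_⟩
    · by_cases e : key i = v.key
      · exact (hocc i e).le
      · rw [hocc' i e]
        have := h.le_max i
        omega
    · by_cases e : key i = v.key
      · exact hv2 i e
      · rw [hocc' i e] at hi
        have := h.le_max i
        rcases hc with hc | ⟨hc, hc'⟩
        · omega
        · exact hc'.le.trans (h.le_of_eq_max i (by omega))
  · push Not at hc
    have hne : key imax ≠ v.key := fun e => by
      have := h.eq_max
      rw [e, ← hv3] at this
      omega
    refine ⟨h.search.incr _, hvert, hex, fun i => ?_, ?_, fun i hi => ?_⟩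
    · by_cases e : key i = v.key
      · rw [hocc i e]; exact hc.1
      · rw [hocc' i e]; exact h.le_max i
    · rw [hocc' _ hne]; exact h.eq_max
    · by_cases e : key i = v.key
      · rw [hocc i e] at hi
        exact (hc.2 hi).trans (hv2 i e)
      · rw [hocc' i e] at hi
        exact h.le_of_eq_max i hi

/-- The tree of the keywords after the first phase. -/
theorem keywordTree_spec (key : Fin d → Fin k → Bool) (js : List (Fin d))
    (hjs : js.Pairwise (· < ·)) :
    let t := js.foldl (fun t j => addVertex ⟨j, key j, 0⟩ t) (.nil : BinaryTree (Vertex d k))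
    IsAVL t ∧ IsSearchTree t ∧ (inorder t).length ≤ js.length ∧
      (∀ v ∈ inorder t, v.idx ∈ js ∧ key v.idx = v.key ∧ (∀ i ∈ js, key i = v.key → v.idx ≤ i) ∧
        v.count = 0) ∧
      ∀ i ∈ js, ∃ v ∈ inorder t, v.key = key i := by
  induction js using List.reverseRecOn with
  | nil => simp [IsAVL, IsSearchTree, inorder]
  | append_singleton js j ih =>
    rw [List.pairwise_append] at hjs
    obtain ⟨h1, -, h2⟩ := hjs
    obtain ⟨ha, hs, hlen, hv, he⟩ := ih h1
    simp only [List.foldl_append, List.foldl_cons, List.foldl_nil]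
    set t := js.foldl (fun t j => addVertex ⟨j, key j, 0⟩ t) (.nil : BinaryTree (Vertex d k))
    obtain ⟨hs', hmem⟩ := hs.addVertex ⟨j, key j, 0⟩
    refine ⟨(ha.addVertex _).1, hs', ?_, fun v hvt => ?_, fun i hi => ?_⟩
    · have := length_inorder_addVertex_le ⟨j, key j, 0⟩ t
      rw [List.length_append, List.length_singleton]
      omega
    · rcases (hmem v).1 hvt with hvt | ⟨rfl, hne⟩
      · obtain ⟨c1, c2, c3, c4⟩ := hv v hvt
        refine ⟨by simp [c1], c2, fun i hi e => ?_, c4⟩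
        rcases List.mem_append.1 hi with hi | hi
        · exact c3 i hi e
        · obtain rfl : i = j := by simpa using hi
          exact (h2 _ c1 _ (by simp)).le
      · refine ⟨by simp, rfl, fun i hi e => ?_, rfl⟩
        rcases List.mem_append.1 hi with hi | hi
        · obtain ⟨u, hu, e'⟩ := he i hi
          exact absurd (e'.trans e) (hne u hu)
        · obtain rfl : i = j := by simpa using hi
          exact le_rfl
    · rcases List.mem_append.1 hi with hi | hi
      · obtain ⟨u, hu, e'⟩ := he i hi
        exact ⟨u, (hmem u).2 (Or.inl hu), e'⟩
      · obtain rfl : i = j := by simpa using hi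
        by_cases hex : ∃ u ∈ inorder t, u.key = key i
        · obtain ⟨u, hu, e⟩ := hex
          exact ⟨u, (hmem u).2 (Or.inl hu), e⟩
        · push Not at hex
          exact ⟨_, (hmem _).2 (Or.inr ⟨rfl, hex⟩), rfl⟩

end Counting

/-! ### The second phase and the cost -/

section Phases

variable {d k n : ℕ} {I : Fin n → Bool} {F : QAlg k (Option (Fin k))}

/-- If all searches of the second phase are right, then the answer at the end is the smallest index
of a keyword with the maximal number of occurrences. -/
theorem le_settleProb_processWords (hF : IsFirstOneSearch F) (reps : ℕ)
    (key : Fin d → Fin k → Bool) (w : ℕ → Fin k → Bool) (l : ℕ) (H : ℕ) (r : ℕ) :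
    ∀ (j : ℕ) (t : BinaryTree (Vertex d k)) (cmax : ℕ) (imax y₀ : Fin d) (b : Bool),
    (∀ i, j ≤ i → i < j + r → buffer k I (l + i + 1) = w i) →
    t.height = H → CountInv key w j t cmax imax →
    (∀ t cmax imax, CountInv key w (j + r) t cmax imax → imax = y₀) →
    ((1 - (1 / 2) ^ reps) ^ H) ^ r ≤
      settleProb I y₀ (processWords F reps r t cmax imax) imax (l + j) b
        (r * (H * (reps * (F.maxQueries + 1)) + 1)) := by
  induction r with
  | zero =>
    intro j t cmax imax y₀ b _ _ hinv hend
    rw [hend t cmax imax hinv, processWords, settleProb_halt, pow_zero]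
  | succ r ih =>
    intro j t cmax imax y₀ b hbuf hH hinv hend
    set M := reps * (F.maxQueries + 1) with hM
    have hbuf' : ∀ i, j + 1 ≤ i → i < j + 1 + r → buffer k I (l + i + 1) = w i :=
      fun i h1 h2 => hbuf i (by omega) (by omega)
    have hend' : ∀ t cmax imax, CountInv key w (j + 1 + r) t cmax imax → imax = y₀ := by
      rwa [add_assoc, add_comm 1 r]
    refine le_trans ?_ ((le_settleProb_load _ _ _ _ _).trans (settleProb_mono _ _ _ _
      (τ := r * (H * M + 1) + H * M + if b then 1 else 0) ?_))
    · rw [pow_succ', ← hH]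
      refine le_settleProb_findVertex hF reps _ _ _ (r * (t.height * M + 1)) t (fun b' => ?_) true
      rw [hbuf j le_rfl (by omega)]
      cases hlk : lookup (w j) t with
      | none =>
        have := ih (j + 1) t cmax imax y₀ b' hbuf' hH (hinv.succ_of_none hlk) hend'
        rw [hH]
        exact this
      | some v =>
        have hinv' := hinv.incr_of_some hlk
        have hH' : (incr v.idx t).height = H := (height_map _ _).trans hH
        rw [hH]
        simp only
        split_ifs with hc
        · rw [if_pos hc] at hinv'
          rw [settleProb_output]
          exact ih (j + 1) _ _ _ y₀ b' hbuf' hH' hinv' hend'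
        · rw [if_neg hc] at hinv'
          exact ih (j + 1) _ _ _ y₀ b' hbuf' hH' hinv' hend'
    · rw [add_one_mul, add_assoc]
      split_ifs <;> omega

end Phases

section Cost

variable {m d k : ℕ} [NeZero d] [NeZero k]

omit [NeZero d] [NeZero k] in
theorem buffer_succ (I : Fin ((m + d) * k) → Bool) (b : Fin (m + d)) :
    buffer k I (b + 1) = block I b := by
  ext q
  have hlt : (b : ℕ) * k + q < (m + d) * k := (finProdFinEquiv (b, q)).2.trans_eq' (by
    simp [mul_comm, add_comm])
  rw [buffer, dif_pos ⟨Nat.succ_pos _, by simpa using hlt⟩, block]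
  congr 1
  ext
  simp [mul_comm, add_comm]

omit [NeZero k] in
theorem eq_mostFrequent (I : Fin ((m + d) * k) → Bool) {t : BinaryTree (Vertex d k)} {cmax : ℕ}
    {imax : Fin d} (h : CountInv (keyword I) (fun i => buffer k I (d + i + 1)) m t cmax imax) :
    imax = mostFrequent I := by
  have hocc : ∀ s, freq I s = (occ (fun i => buffer k I (d + i + 1)) m s : ℚ) / m := by
    intro s
    rw [freq, occ]
    congr 2
    refine Finset.card_bij (fun j _ => j.1) ?_ ?_ ?_
    · intro j hj
      have e : word I j = buffer k I (d + j + 1) :=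
        (buffer_succ I ⟨d + j, by omega⟩).symm
      simpa [← e] using hj
    · intro a _ b _ e
      exact Fin.ext e
    · intro i hi
      simp only [Finset.mem_filter, Finset.mem_range] at hi
      refine ⟨⟨i, hi.1⟩, ?_, rfl⟩
      have e : word I ⟨i, hi.1⟩ = buffer k I (d + i + 1) :=
        (buffer_succ I ⟨d + i, by omega⟩).symm
      simp [e, hi.2]
  have hmono : ∀ i, freq I (keyword I i) ≤ freq I (keyword I imax) := by
    intro i
    rw [hocc, hocc, h.eq_max]
    gcongr
    exact h.le_max i
  refine le_antisymm (Finset.le_min' _ _ _ fun i hi => ?_) (Finset.min'_le _ _ (by simpa using hmono))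
  rcases Nat.eq_zero_or_pos m with hm | hm
  · refine h.le_of_eq_max i ?_
    have h0 := h.eq_max
    have : ∀ s, occ (fun i => buffer k I (d + i + 1)) m s = 0 := by
      intro s
      have h1 : Finset.range m = ∅ := by simp [hm]
      rw [occ, h1]
      rfl
    rw [this] at h0 ⊢
    exact h0
  · refine h.le_of_eq_max i (le_antisymm (h.le_max i) ?_)
    have h1 : freq I (keyword I imax) ≤ freq I (keyword I i) := by
      simp only [Finset.mem_filter, Finset.mem_univ, true_and] at hi
      exact hi imax
    rw [hocc, hocc, h.eq_max] at h1
    have hm' : (0 : ℚ) < m := by exact_mod_cast hm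
    exact_mod_cast (div_le_div_iff_of_pos_right hm').1 h1

/-- The algorithm settles on the right answer after a time that depends on the height of the
tree, which is logarithmic in the number of keywords. -/
theorem exists_le_settleProb_keywordAlg {F : QAlg k (Option (Fin k))} (hF : IsFirstOneSearch F)
    (I : Fin ((m + d) * k) → Bool) : ∃ H : ℕ, 2 ^ H ≤ (d + 1) ^ 2 ∧
    (1 - (1 / 2) ^ (1 + ⌈3 * Real.logb 2 m⌉₊)) ^ (H * m) ≤
      settleProb I (mostFrequent I) (keywordAlg m d k F).prog 0 0 false
        (m * (H * ((1 + ⌈3 * Real.logb 2 m⌉₊) * (F.maxQueries + 1)) + 1) + d * k) := by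
  obtain ⟨ha, hs, hlen, hv, he⟩ :=
    keywordTree_spec (keyword I) (List.finRange d) (List.pairwise_lt_finRange d)
  set t := (List.finRange d).foldl (fun t j => addVertex ⟨j, keyword I j, 0⟩ t)
    (.nil : BinaryTree (Vertex d k)) with ht
  refine ⟨t.height, ha.two_pow_height_le.trans ?_, ?_⟩
  · rw [← length_inorder]
    rw [List.length_finRange] at hlen
    gcongr
  · have hinv : CountInv (keyword I) (fun i => buffer k I (d + i + 1)) 0 t 0 0 := by
      refine ⟨hs, fun v hvt => ?_, fun i => he i (by simp), fun i => by simp [occ],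
        by simp [occ], fun i _ => Fin.zero_le _⟩
      obtain ⟨-, h1, h2, h3⟩ := hv v hvt
      exact ⟨h1, fun i => h2 i (by simp), by simp [h3, occ]⟩
    have h1 := le_settleProb_processWords (I := I) hF (1 + ⌈3 * Real.logb 2 m⌉₊) (keyword I)
      (fun i => buffer k I (d + i + 1)) d t.height m 0 t 0 0 (mostFrequent I) false
      (fun _ _ _ => rfl) rfl hinv (fun t' c i h => by
        rw [zero_add] at h
        exact eq_mostFrequent I h)
    have h2 := le_settleProb_readKeywords (I := I) (y₀ := mostFrequent I)
      (fun t => processWords F (1 + ⌈3 * Real.logb 2 m⌉₊) m t 0 0) (keyword I) 0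
      (m * (t.height * ((1 + ⌈3 * Real.logb 2 m⌉₊) * (F.maxQueries + 1)) + 1))
      (List.finRange d) .nil 0 (fun i h => by
        have hi : i < d := by simpa using h
        rw [zero_add, buffer_succ I ⟨i, by omega⟩]
        simp [keyword])
    rw [List.length_finRange, zero_add, ← ht] at h2
    rw [pow_mul]
    exact h1.trans h2

theorem one_le_opt_keywordCost (I : Fin ((m + d) * k) → Bool) :
    1 ≤ (keywordCost m d k).opt I := by
  refine le_ciInf fun O => ?_
  have : ∑ j : Fin m, (if O (significant j) = mostFrequent I then (1 : ℝ) else 0) ≤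
      ∑ _j : Fin m, (1 : ℝ) := Finset.sum_le_sum fun j _ => by split_ifs <;> norm_num
  simp only [Finset.sum_const, Finset.card_univ, Fintype.card_fin, nsmul_eq_mul, mul_one] at this
  rw [keywordCost]
  linarith

theorem sum_toReal_eq_one {α : Type*} [Fintype α] (μ : PMF α) :
    ∑ x, (μ x).toReal = 1 := by
  have h := μ.tsum_coe
  rw [tsum_fintype] at h
  rw [← ENNReal.toReal_sum fun x _ => μ.apply_ne_top x, h]
  rfl

omit [NeZero d] [NeZero k] in
theorem expCost_le_of_forall_le (A : OnlineAlg k (Fin d)) (R : ℕ)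
    (cost : CostFun ((m + d) * k) (Fin d)) (I : Fin ((m + d) * k) → Bool) {B : ℝ}
    (h : ∀ O, cost I O ≤ B) : A.expCost R cost I ≤ B := by
  calc A.expCost R cost I ≤ ∑ O, (A.outputDist R I O).toReal * B :=
        Finset.sum_le_sum fun O _ => by gcongr; exact h O
    _ = B := by rw [← Finset.sum_mul, sum_toReal_eq_one, one_mul]

/-- If the algorithm settles on the right answer within `T` rounds after the keywords, then only the
significant output variables that are requested before have to be paid for. -/
theorem expCost_le_of_settleProb (A : OnlineAlg k (Fin d)) {R : ℕ} (hR : 1 ≤ R)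
    (I : Fin ((m + d) * k) → Bool) (T : ℕ) {p : ℝ}
    (hp : ENNReal.ofReal p ≤
      settleProb I (mostFrequent I) A.prog A.initial 0 false (T + d * k)) :
    A.expCost R (keywordCost m d k) I ≤ 1 + T / k + m * (1 - p) := by
  classical
  have hk : 0 < k := Nat.pos_of_ne_zero (NeZero.ne k)
  set G : Set (Fin ((m + d) * k) → Fin d) :=
    {O | ∀ j : Fin m, T ≤ (j + 1) * k → O (significant j) = mostFrequent I} with hG
  have hPG : p ≤ ∑ O, if O ∈ G then (A.outputDist R I O).toReal else 0 := by
    have h1 : ENNReal.ofReal p ≤ (A.outputDist R I).toOuterMeasure G := by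
      refine hp.trans ?_
      rw [OnlineAlg.outputDist, PMF.toOuterMeasure_map_apply]
      refine MeasureTheory.measure_mono fun g hg j hj => ?_
      refine hg _ ?_
      have h2 : ((j : ℕ) + 1 + d) * k = (j + 1) * k + d * k := by ring
      -- The request comes after a multiple of `R` rounds that is larger than the index counted from `0`.
      have h3 := Nat.lt_div_mul_add (a := ((j : ℕ) + 1 + d) * k - 1) (b := R) hR
      simp only [significant]
      rw [add_one_mul]
      omega
    rw [PMF.toOuterMeasure_apply_fintype] at h1
    have h2 := (ENNReal.ofReal_le_iff_le_toReal (by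
      refine ENNReal.sum_ne_top.2 fun O _ => ?_
      refine ne_top_of_le_ne_top ((A.outputDist R I).apply_ne_top O) ?_
      exact Set.indicator_le_self _ _ _)).1 h1
    rw [ENNReal.toReal_sum fun O _ => ne_top_of_le_ne_top ((A.outputDist R I).apply_ne_top O)
      (Set.indicator_le_self _ _ _)] at h2
    refine h2.trans (le_of_eq (Finset.sum_congr rfl fun O _ => ?_))
    by_cases hO : O ∈ G <;> simp [hO]
  have hbad : ((Finset.univ.filter fun j : Fin m => ¬ T ≤ (j + 1) * k).card : ℝ) ≤ T / k := by
    have h1 : (Finset.univ.filter fun j : Fin m => ¬ T ≤ (j + 1) * k).card ≤ T / k := by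
      rw [← Finset.card_range (T / k)]
      refine Finset.card_le_card_of_injOn (fun j => j.1) ?_ (fun a _ b _ e => Fin.ext e)
      intro j hj
      simp only [Finset.coe_filter, Finset.mem_univ, true_and, Set.mem_ofPred_eq, not_le] at hj
      simp only [Finset.coe_range, Set.mem_Iio]
      exact (Nat.le_div_iff_mul_le hk).2 hj.le
    calc _ ≤ ((T / k : ℕ) : ℝ) := by exact_mod_cast h1
      _ ≤ T / k := Nat.cast_div_le
  have hcost : ∀ O, keywordCost m d k I O ≤ 1 + T / k + m * (1 - if O ∈ G then 1 else 0) := by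
    intro O
    rw [keywordCost]
    split_ifs with hO
    · have h1 : (∑ _j : Fin m, (1 : ℝ)) ≤
          ∑ j : Fin m, ((if O (significant j) = mostFrequent I then 1 else 0) +
            if ¬ T ≤ ((j : ℕ) + 1) * k then 1 else 0) := by
        refine Finset.sum_le_sum fun j _ => ?_
        by_cases hj : T ≤ ((j : ℕ) + 1) * k
        · simp [hO j hj, hj]
        · rw [if_pos hj]
          split_ifs <;> norm_num
      rw [Finset.sum_add_distrib, Finset.sum_boole (fun j : Fin m => ¬ T ≤ ((j : ℕ) + 1) * k)] at h1
      simp only [Finset.sum_const, Finset.card_univ, Fintype.card_fin, nsmul_eq_mul, mul_one] at h1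
      linarith
    · have h1 : 0 ≤ ∑ j : Fin m, (if O (significant j) = mostFrequent I then (1 : ℝ) else 0) :=
        Finset.sum_nonneg fun j _ => by split_ifs <;> norm_num
      have : (0 : ℝ) ≤ T / k := by positivity
      linarith
  calc A.expCost R (keywordCost m d k) I
      ≤ ∑ O, (A.outputDist R I O).toReal * (1 + T / k + m * (1 - if O ∈ G then 1 else 0)) :=
        Finset.sum_le_sum fun O _ => by gcongr; exact hcost O
    _ = (1 + T / k + m) * (∑ O, (A.outputDist R I O).toReal) -
        m * ∑ O, if O ∈ G then (A.outputDist R I O).toReal else 0 := by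
        rw [Finset.mul_sum, Finset.mul_sum, ← Finset.sum_sub_distrib]
        refine Finset.sum_congr rfl fun O _ => ?_
        split_ifs <;> ring
    _ ≤ 1 + T / k + m * (1 - p) := by
        rw [sum_toReal_eq_one]
        have : (m : ℝ) * p ≤ m * ∑ O, if O ∈ G then (A.outputDist R I O).toReal else 0 := by
          gcongr
        linarith

/-- The main case of the bound, where both logarithms are at least `1` and absorb the lower-order
terms. -/
theorem expCost_keywordAlg_le {c A : ℝ} {R : ℕ} (hm : 2 ≤ m) (hd : 2 ≤ d) (hR : 1 ≤ R)
    (hA : Real.logb 2 d ≤ A * m) {F : QAlg k (Option (Fin k))} (hF : IsFirstOneSearch F)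
    (hc : (F.maxQueries : ℝ) ≤ c * √(k : ℝ)) (I : Fin ((m + d) * k) → Bool) :
    (keywordAlg m d k F).expCost R (keywordCost m d k) I ≤
      1 + 2 * A + (20 * c + 21) * (m * Real.logb 2 m * Real.logb 2 d / √(k : ℝ)) := by
  obtain ⟨H, hH, hset⟩ := exists_le_settleProb_keywordAlg hF I
  set r := 1 + ⌈3 * Real.logb 2 m⌉₊ with hr
  set T := m * (H * (r * (F.maxQueries + 1)) + 1) with hT
  set M := F.maxQueries with hM
  set Lm := Real.logb 2 m with hLm
  set Ld := Real.logb 2 d with hLd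
  have hm' : (2 : ℝ) ≤ m := by exact_mod_cast hm
  have hd' : (2 : ℝ) ≤ d := by exact_mod_cast hd
  have hk' : (1 : ℝ) ≤ k := by exact_mod_cast Nat.pos_of_ne_zero (NeZero.ne k)
  have hLm1 : 1 ≤ Lm := by
    rw [hLm, Real.le_logb_iff_rpow_le (by norm_num) (by linarith)]; simpa using hm'
  have hLd1 : 1 ≤ Ld := by
    rw [hLd, Real.le_logb_iff_rpow_le (by norm_num) (by linarith)]; simpa using hd'
  have hHle : (H : ℝ) ≤ 4 * Ld := by
    have h1 : (2 : ℝ) ^ H ≤ d ^ 4 := by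
      have : (2 : ℝ) ^ H ≤ (d + 1) ^ 2 := by exact_mod_cast hH
      have h2 : (d : ℝ) + 1 ≤ d ^ 2 := by nlinarith
      calc (2 : ℝ) ^ H ≤ (d + 1) ^ 2 := this
        _ ≤ (d ^ 2) ^ 2 := by gcongr
        _ = d ^ 4 := by ring
    have h2 := Real.logb_le_logb_of_le (b := 2) (by norm_num) (by positivity) h1
    rw [Real.logb_pow, Real.logb_pow, Real.logb_self_eq_one (by norm_num)] at h2
    simpa using h2
  have hr5 : (r : ℝ) ≤ 5 * Lm := by
    have := (Nat.ceil_lt_add_one (a := 3 * Lm) (by linarith)).le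
    rw [hr]
    push_cast
    linarith
  have hfail : (1 / 2 : ℝ) ^ r ≤ 1 / (2 * m ^ 3) := by
    have h1 : (m : ℝ) ^ 3 ≤ 2 ^ ⌈3 * Lm⌉₊ := by
      rw [← Real.rpow_natCast 2, ← Real.logb_le_iff_le_rpow (by norm_num) (by positivity),
        Real.logb_pow]
      exact Nat.le_ceil _
    rw [hr, div_pow, one_pow, pow_add, pow_one]
    gcongr
  have hp : ENNReal.ofReal (1 - (H * m : ℕ) * (1 / 2) ^ r) ≤
      settleProb I (mostFrequent I) (keywordAlg m d k F).prog (keywordAlg m d k F).initial 0 false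
        (T + d * k) := by
    refine le_trans ?_ hset
    have h1 : (1 - (1 / 2 : ℝ≥0∞) ^ r) = ENNReal.ofReal (1 - (1 / 2) ^ r) := by
      rw [ENNReal.ofReal_sub _ (by positivity), ENNReal.ofReal_pow (by norm_num),
        ENNReal.ofReal_div_of_pos (by norm_num)]
      simp
    have h2 : (1 / 2 : ℝ) ^ r ≤ 1 := pow_le_one₀ (by norm_num) (by norm_num)
    rw [h1, ← ENNReal.ofReal_pow (by linarith)]
    apply ENNReal.ofReal_le_ofReal
    have := one_add_mul_le_pow (a := -(1 / 2 : ℝ) ^ r) (by linarith) (H * m)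
    rw [← sub_eq_add_neg] at this
    linarith
  refine (expCost_le_of_settleProb _ hR I T hp).trans ?_
  have hs0 : 0 < √(k : ℝ) := by positivity
  have hs1 : 1 ≤ √(k : ℝ) := Real.one_le_sqrt.2 hk'
  have hc0 : 0 ≤ c := by
    by_contra h
    have : c * √(k : ℝ) < 0 := mul_neg_of_neg_of_pos (not_le.1 h) hs0
    linarith [(Nat.cast_nonneg M : (0 : ℝ) ≤ M)]
  have hTk : (T : ℝ) / k ≤ (20 * c + 21) * (m * Lm * Ld / √(k : ℝ)) := by
    have h1 : (H : ℝ) * (r * (M + 1)) + 1 ≤ (20 * c + 21) * Lm * Ld * √(k : ℝ) := by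
      have h2 : (M : ℝ) + 1 ≤ (c + 1) * √(k : ℝ) := by linarith
      have h3 : 1 ≤ Lm * Ld * √(k : ℝ) :=
        one_le_mul_of_one_le_of_one_le (one_le_mul_of_one_le_of_one_le hLm1 hLd1) hs1
      calc (H : ℝ) * (r * (M + 1)) + 1
          ≤ 4 * Ld * (5 * Lm * ((c + 1) * √(k : ℝ))) + Lm * Ld * √(k : ℝ) := by gcongr
        _ = _ := by ring
    have e : (m : ℝ) * Lm * Ld / √(k : ℝ) = m * Lm * Ld * √(k : ℝ) / k := by
      rw [div_eq_div_iff hs0.ne' (by linarith), mul_assoc _ √(k : ℝ) √(k : ℝ),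
        Real.mul_self_sqrt (by linarith)]
    rw [e, mul_div_assoc', hT]
    push_cast
    gcongr ?_ / _
    calc (m : ℝ) * (H * (r * (M + 1)) + 1) ≤ m * ((20 * c + 21) * Lm * Ld * √(k : ℝ)) := by gcongr
      _ = _ := by ring
  have hA0 : 0 ≤ A := by
    by_contra h
    nlinarith
  have hPf : (m : ℝ) * (1 - (1 - (H * m : ℕ) * (1 / 2) ^ r)) ≤ 2 * A := by
    calc (m : ℝ) * (1 - (1 - (H * m : ℕ) * (1 / 2) ^ r))
        = m * (H * m * (1 / 2) ^ r) := by push_cast; ring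
      _ ≤ m * (4 * (A * m) * m * (1 / (2 * m ^ 3))) := by
          gcongr
          linarith
      _ = 2 * A := by field_simp; ring
  linarith

theorem keywordAlg_isCompetitive (c A : ℝ) : ∃ C : ℝ, ∀ (m d k R : ℕ) [NeZero m] [NeZero d]
    [NeZero k], 1 ≤ R → R ≤ k → Real.logb 2 d ≤ A * m →
      ∀ F : QAlg k (Option (Fin k)), IsFirstOneSearch F → (F.maxQueries : ℝ) ≤ c * √(k : ℝ) →
        (keywordAlg m d k F).IsCompetitive R (keywordCost m d k)
          (C * (1 + m * Real.logb 2 m * Real.logb 2 d / √(k : ℝ))) 0 := by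
  refine ⟨23 + 2 * |A| + 20 * |c|, fun m d k R _ _ _ hR _ hA F hF hc I => ?_⟩
  have hm : 1 ≤ m := Nat.pos_of_ne_zero (NeZero.ne m)
  have hd : 1 ≤ d := Nat.pos_of_ne_zero (NeZero.ne d)
  set X := m * Real.logb 2 m * Real.logb 2 d / √(k : ℝ) with hX
  have hX0 : 0 ≤ X := by
    have h1 : 0 ≤ Real.logb 2 m := Real.logb_nonneg (by norm_num) (by exact_mod_cast hm)
    have h2 : 0 ≤ Real.logb 2 d := Real.logb_nonneg (by norm_num) (by exact_mod_cast hd)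
    positivity
  have hA0 := abs_nonneg A
  have hc0 := abs_nonneg c
  have hAX : 0 ≤ |A| * X := by positivity
  have hcX : 0 ≤ |c| * X := by positivity
  suffices h : (keywordAlg m d k F).expCost R (keywordCost m d k) I ≤
      (23 + 2 * |A| + 20 * |c|) * (1 + X) by
    rw [add_zero]
    exact h.trans (le_mul_of_one_le_right (by positivity) (one_le_opt_keywordCost I))
  rcases Nat.lt_or_ge m 2 with hm2 | hm2
  -- For one word or one keyword the bound is just `C`, since a logarithm vanishes.
  · obtain rfl : m = 1 := by omega
    have := expCost_le_of_forall_le (keywordAlg 1 d k F) R (keywordCost 1 d k) I (B := 2)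
      fun O => by
        rw [keywordCost]
        have : 0 ≤ ∑ j : Fin 1, (if O (significant j) = mostFrequent I then (1 : ℝ) else 0) :=
          Finset.sum_nonneg fun j _ => by split_ifs <;> norm_num
        norm_num at this ⊢
    nlinarith
  rcases Nat.lt_or_ge d 2 with hd2 | hd2
  · obtain rfl : d = 1 := by omega
    have := expCost_le_of_forall_le (keywordAlg m 1 k F) R (keywordCost m 1 k) I (B := 1)
      fun O => by
        rw [keywordCost]
        simp [Subsingleton.elim _ (mostFrequent I)]
    nlinarith
  · have := expCost_keywordAlg_le hm2 hd2 hR hA hF hc I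
    have h1 : c * X ≤ |c| * X := by gcongr; exact le_abs_self c
    have h2 := le_abs_self A
    linarith

end Cost

end QBuffer

theorem theorem1 :
    (∃ c : ℝ, ∀ N : ℕ, 1 ≤ N → ∃ F : QBuffer.QAlg N (Option (Fin N)),
      QBuffer.IsFirstOneSearch F ∧ (F.maxQueries : ℝ) ≤ c * √(N : ℝ)) ∧
    ∀ c A : ℝ, ∃ C : ℝ, ∀ (m d k R : ℕ) [NeZero m] [NeZero d] [NeZero k],
      1 ≤ R → R ≤ k → Real.logb 2 d ≤ A * m →
      ∀ F : QBuffer.QAlg k (Option (Fin k)), QBuffer.IsFirstOneSearch F →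
        (F.maxQueries : ℝ) ≤ c * √(k : ℝ) →
        (QBuffer.keywordAlg m d k F).IsCompetitive R (QBuffer.keywordCost m d k)
          (C * (1 + m * Real.logb 2 m * Real.logb 2 d / √(k : ℝ))) 0 :=
  ⟨QBuffer.exists_firstOneSearch, QBuffer.keywordAlg_isCompetitive⟩
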